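/- All graphs $G=(V,E)$ are finite, simple and undirected, with $V\neq\emptyset$; $G[A]$ is the subgraph induced by $A\subseteq V$. **Cographs, primitive graphs, pseudo-cographs.** Cographs are defined recursively: $K_1$ is a cograph, and the join and the disjoint union of two vertex-disjoint cographs are cographs. A module of $G$ is a nonempty set $M\subseteq V$ such that any two vertices of $M$ have the same neighbours outside $M$. $G$ is primitive if $|V|\ge 4$ and its only modules are the singletons and $V$. $G$ is a pseudo-cograph if $|V|\le 2$, or there are a vertex $v$ and induced subgraphs $G_1,G_2$ of $G$ with $V(G_1)\cup V(G_2)=V$, $V(G_1)\cap V(G_2)=\{v\}$, $|V(G_1)|,|V(G_2)|>1$, such that $G_1,G_2$ are cographs and $G-v$ is the join or the disjoint union of $G_1-v$ and $G_2-v$. **Galled-trees and GaTEx graphs.** A galled-tree with leaf set $X$ is a finite directed acyclic graph $N=(W,A)$ such that either $W=X=\{x\}$, or: (N1) there is a unique vertex $\rho$ (the root) with indegree $0$ and outdegree at least $2$; (N2) $x\in X$ if and only if $x$ has outdegree $0$ and indegree $1$; (N3) every $v\in W\setminus X$ with $v\ne\rho$ has either indegree $1$ and outdegree at least $2$, or indegree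 $2$ and outdegree at least $1$ (then $v$ is a hybrid-vertex); (N4) each biconnected component of the underlying undirected graph (a maximal connected subgraph that the removal of any single vertex does not disconnect) contains at most one hybrid-vertex $v$ both of whose parents also lie in that component. A labeling is a map $t\colon W\to\{0,1,\odot\}$ with $t(w)=\odot$ if and only if $w\in X$. The pair $(N,t)$ explains the graph on $X$ in which distinct $x,y$ are adjacent if and only if $t(\mathrm{lca}_N(x,y))=1$, where $\mathrm{lca}_N(x,y)$ is the (unique) lowest common ancestor of $x$ and $y$. $G$ is galled-tree explainable (GaTEx) if it is isomorphic to a graph explained by some labeled galled-tree. **Twin-width.** A trigraph has a vertex set and two disjoint sets $B$ (black) and $R$ (red) of edges; a graph is a trigraph with $R=\emptyset$. A $d$-trigraph is a trigraph in which every vertex is in at most $d$ red edges. Contracting two distinct vertices $u,v$ of a trigraph replaces them by one new vertex $w$, keeps all edges among the other vertices, and for every other vertex $x$ makes $wx$ black if $ux$ and $vx$ are both black, makes $wx$ a non-edge if $ux$ and $vx$ are both non-edges, and makes $wx$ red otherwise. A trigraph $G$ on $n$ vertices is $d$-collapsible if there is a sequence of $d$-trigraphs $G=G_n,G_{n-1},\dots,G_1$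 in which each $G_{i-1}$ is a contraction of $G_i$ (so $G_1$ is a single vertex). The twin-width $\mathrm{tww}(G)$ is the least $d$ such that $G$ is $d$-collapsible. **Theorem.** 1. Every primitive pseudo-cograph $G$ is $1$-collapsible, and $\mathrm{tww}(G)=1$. 2. Every GaTEx graph $G$ is $1$-collapsible, that is, $\mathrm{tww}(G)\le 1$; moreover $\mathrm{tww}(G)=1$ if and only if $G$ is not a cograph. -/

import Mathlib

/-! ## Modules, primitive graphs, cographs and pseudo-cographs -/

namespace SimpleGraph

variable {V : Type*}

/-- `M` is a module of `G`: any two vertices of `M` have the same neighbours outside `M`. -/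
def IsModule (G : SimpleGraph V) (M : Set V) : Prop :=
  ∀ x ∈ M, ∀ y ∈ M, G.neighborSet x \ M = G.neighborSet y \ M

/-- `G` is primitive: it has at least four vertices, and its only nonempty modules are the
singletons and the whole vertex set. -/
def IsPrimitive (G : SimpleGraph V) : Prop :=
  4 ≤ Nat.card V ∧
    ∀ M : Set V, M.Nonempty → G.IsModule M → (∃ x, M = {x}) ∨ M = Set.univ

/-- `G.IsCographOn A`: the induced subgraph `G[A]` is a cograph. Cographs are built from the
one-vertex graphs by disjoint unions and joins of vertex-disjoint cographs. -/
inductive IsCographOn (G : SimpleGraph V) : Set V → Prop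
  | single (x : V) : IsCographOn G {x}
  | disjointUnion (A B : Set V) : IsCographOn G A → IsCographOn G B → Disjoint A B →
      (∀ a ∈ A, ∀ b ∈ B, ¬ G.Adj a b) → IsCographOn G (A ∪ B)
  | join (A B : Set V) : IsCographOn G A → IsCographOn G B → Disjoint A B →
      (∀ a ∈ A, ∀ b ∈ B, G.Adj a b) → IsCographOn G (A ∪ B)

/-- `G` is a cograph. -/
def IsCograph (G : SimpleGraph V) : Prop := G.IsCographOn Set.univ

/-- `G` is a `(v, G[A], G[B])`-pseudo-cograph. -/
structure IsPseudoCographWith (G : SimpleGraph V) (v : V) (A B : Set V) : Prop where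
  union_eq : A ∪ B = Set.univ
  inter_eq : A ∩ B = {v}
  one_lt_left : 1 < A.ncard
  one_lt_right : 1 < B.ncard
  cograph_left : G.IsCographOn A
  cograph_right : G.IsCographOn B
  /-- `G - v` is the join or the disjoint union of `G[A] - v` and `G[B] - v`. -/
  join_or_union :
    (∀ a ∈ A \ {v}, ∀ b ∈ B \ {v}, G.Adj a b) ∨ (∀ a ∈ A \ {v}, ∀ b ∈ B \ {v}, ¬ G.Adj a b)

/-- `G` is a pseudo-cograph. -/
def IsPseudoCograph (G : SimpleGraph V) : Prop :=
  Nat.card V ≤ 2 ∨ ∃ (v : V) (A B : Set V), G.IsPseudoCographWith v A B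

/-- A graph or subgraph is biconnected if it is connected and the removal of any one of its
vertices does not disconnect it (single vertices and single edges are biconnected). -/
def Subgraph.IsBiconnected {G : SimpleGraph V} (C : G.Subgraph) : Prop :=
  C.Connected ∧ ∀ v ∈ C.verts, (C.deleteVerts {v}).Preconnected

/-- A biconnected component is a maximal biconnected subgraph. -/
def Subgraph.IsBiconnectedComponent {G : SimpleGraph V} (C : G.Subgraph) : Prop :=
  Maximal Subgraph.IsBiconnected C

end SimpleGraph

/-! ## Galled-trees and galled-tree explainable graphs -/

namespace Digraph

variable {W : Type*}

/-- Number of arcs that end in `v`. -/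
noncomputable def inDeg (N : Digraph W) (v : W) : ℕ := {u | N.Adj u v}.ncard

/-- Number of arcs that start in `v`. -/
noncomputable def outDeg (N : Digraph W) (v : W) : ℕ := {u | N.Adj v u}.ncard

/-- There is no directed cycle (in particular no loop). -/
def IsAcyclic (N : Digraph W) : Prop := ∀ v, ¬ Relation.TransGen N.Adj v v

/-- `v` is a hybrid-vertex: indegree 2 and outdegree at least 1. -/
def IsHybrid (N : Digraph W) (v : W) : Prop := N.inDeg v = 2 ∧ 1 ≤ N.outDeg v

/-- `v` is a (non-root) tree-vertex: indegree 1 and outdegree at least 2. -/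
def IsTreeVertex (N : Digraph W) (v : W) : Prop := N.inDeg v = 1 ∧ 2 ≤ N.outDeg v

/-- `N` is a galled-tree with leaf set `X`. -/
def IsGalledTree (N : Digraph W) (X : Set W) : Prop :=
  N.IsAcyclic ∧
  ((∃ x : W, X = {x} ∧ X = Set.univ) ∨
    ((∃ r : W, (N.inDeg r = 0 ∧ 2 ≤ N.outDeg r) ∧
        (∀ w, N.inDeg w = 0 ∧ 2 ≤ N.outDeg w → w = r) ∧
        ∀ v, v ∉ X → v ≠ r → N.IsTreeVertex v ∨ N.IsHybrid v) ∧
      (∀ x, x ∈ X ↔ N.outDeg x = 0 ∧ N.inDeg x = 1) ∧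
      -- each biconnected component contains at most one hybrid-vertex together with both
      -- of its parents
      (∀ C : N.toSimpleGraphInclusive.Subgraph, C.IsBiconnectedComponent →
        {v | v ∈ C.verts ∧ N.IsHybrid v ∧ ∀ u, N.Adj u v → u ∈ C.verts}.Subsingleton)))

/-- `N.IsAncestor u v`: there is a directed path, possibly of length 0, from `u` to `v`. -/
def IsAncestor (N : Digraph W) (u v : W) : Prop := Relation.ReflTransGen N.Adj u v

/-- `u` is a lowest common ancestor of `A`: no proper descendant of `u` is a common ancestor
of `A`. (For leaves of a galled-tree there is exactly one.) -/
def IsLCA (N : Digraph W) (A : Set W) (u : W) : Prop :=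
  (∀ a ∈ A, N.IsAncestor u a) ∧
    ∀ w, (∀ a ∈ A, N.IsAncestor w a) → N.IsAncestor u w → w = u

end Digraph

/-- The labels `0`, `1` and `⊙` of the vertices of a labeled galled-tree. -/
inductive NodeLabel
  | zero
  | one
  | leaf

/-- `t` labels exactly the vertices of `X` with `⊙`. -/
def IsNodeLabeling {W : Type*} (X : Set W) (t : W → NodeLabel) : Prop :=
  ∀ w, t w = NodeLabel.leaf ↔ w ∈ X

/-- The graph on `X` explained by `(N, t)`: distinct `x, y ∈ X` are adjacent precisely if their
lowest common ancestor has label `1`. -/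
def Digraph.explainedGraph {W : Type*} (N : Digraph W) (X : Set W) (t : W → NodeLabel) :
    SimpleGraph X where
  Adj x y := x ≠ y ∧ ∃ u, N.IsLCA {(x : W), (y : W)} u ∧ t u = NodeLabel.one
  symm := ⟨fun x y h => ⟨h.1.symm, by rw [Set.pair_comm]; exact h.2⟩⟩
  loopless := ⟨fun _ h => h.1 rfl⟩

/-- `G` is galled-tree explainable: it is isomorphic to the graph explained by some (finite)
labeled galled-tree. -/
def SimpleGraph.IsGaTEx {V : Type*} (G : SimpleGraph V) : Prop :=
  ∃ (W : Type) (_ : Finite W) (N : Digraph W) (X : Set W) (t : W → NodeLabel),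
    N.IsGalledTree X ∧ IsNodeLabeling X t ∧ Nonempty (G ≃g N.explainedGraph X t)

/-! ## Trigraphs and twin-width -/

/-- A trigraph whose vertices are taken from `V`, with disjoint sets of black and red edges. -/
structure Trigraph (V : Type*) where
  verts : Set V
  black : SimpleGraph V
  red : SimpleGraph V
  black_mem : ∀ {x y}, black.Adj x y → x ∈ verts ∧ y ∈ verts
  red_mem : ∀ {x y}, red.Adj x y → x ∈ verts ∧ y ∈ verts
  disjoint : Disjoint black red

namespace Trigraph

variable {V : Type*}

/-- All vertices have red degree at most `d`. -/
def IsDTrigraph (d : ℕ) (T : Trigraph V) : Prop :=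
  ∀ v ∈ T.verts, (T.red.neighborSet v).ncard ≤ d

/-- `T'` arises from `T` by contracting the distinct vertices `u, v` into the vertex `w`. The
name `w` of the new vertex is free, but must not be that of a remaining vertex. -/
structure IsContractionOf (T' T : Trigraph V) (u v w : V) : Prop where
  left_mem : u ∈ T.verts
  right_mem : v ∈ T.verts
  ne : u ≠ v
  fresh : w ∉ T.verts \ {u, v}
  verts_eq : T'.verts = insert w (T.verts \ {u, v})
  black_rest : ∀ x ∈ T.verts \ {u, v}, ∀ y ∈ T.verts \ {u, v},
    (T'.black.Adj x y ↔ T.black.Adj x y)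
  red_rest : ∀ x ∈ T.verts \ {u, v}, ∀ y ∈ T.verts \ {u, v},
    (T'.red.Adj x y ↔ T.red.Adj x y)
  black_new : ∀ x ∈ T.verts \ {u, v},
    (T'.black.Adj w x ↔ T.black.Adj u x ∧ T.black.Adj v x)
  nonadj_new : ∀ x ∈ T.verts \ {u, v},
    (¬ (T'.black.Adj w x ∨ T'.red.Adj w x) ↔
      ¬ (T.black.Adj u x ∨ T.red.Adj u x) ∧ ¬ (T.black.Adj v x ∨ T.red.Adj v x))

/-- `T` is `d`-collapsible: with `n` the number of vertices of `T`, there are `d`-trigraphs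
`T = S n, S (n - 1), …, S 1`, each but the first a contraction of the one before, that end
in a single vertex. -/
def IsCollapsible (d : ℕ) (T : Trigraph V) : Prop :=
  ∃ S : ℕ → Trigraph V, S T.verts.ncard = T ∧
    (∀ i, 1 ≤ i → i ≤ T.verts.ncard → (S i).IsDTrigraph d) ∧
    (∀ i, 1 ≤ i → i < T.verts.ncard → ∃ u v w, (S i).IsContractionOf (S (i + 1)) u v w) ∧
    ∃ x, (S 1).verts = {x}

end Trigraph

namespace SimpleGraph

variable {V : Type*}

/-- A graph as a trigraph without red edges. -/
def toTrigraph (G : SimpleGraph V) : Trigraph V where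
  verts := Set.univ
  black := G
  red := ⊥
  black_mem := fun _ => ⟨Set.mem_univ _, Set.mem_univ _⟩
  red_mem := fun h => h.elim
  disjoint := disjoint_bot_right

/-- `G` is `d`-collapsible. -/
def IsCollapsible (d : ℕ) (G : SimpleGraph V) : Prop := G.toTrigraph.IsCollapsible d

/-- The twin-width of `G`: the least `d` such that `G` is `d`-collapsible. -/
noncomputable def twinWidth (G : SimpleGraph V) : ℕ := sInf {d | G.IsCollapsible d}

end SimpleGraph

/-!
The argument works with a graph whose pairs of vertices are coloured black, white or red, and with
contractions that keep one of the two names (`EdgeColouring.Collapses`). Two rules suffice besides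
the definition: a red pair is never better than a pair of another colour (`Collapses.mono`), and a
module without red edges to the outside may be collapsed first (`Collapses.of_module`).

The common feature of pseudo-cographs and of graphs explained by galled-trees is a *polar
labeling* of every set `Y` of at least two vertices: integer levels that form two caterpillars
hanging off level zero (`SimpleGraph.IsPolarLabeling`). Its level sets are modules, so by induction
only injective levels matter. Then the positive vertices are contracted one after the other into
the lowest of them, `a`, and after that the negative ones into the vertex `v` of level zero. At all
times the only red edge is `av` (`SimpleGraph.IsPolarLabeling.collapses_redPair`). Hence a graph
all of whose sets of at least two vertices have polar labelings is `1`-collapsible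
(`SimpleGraph.collapses_of_hasPolarLabeling`).

In a pseudo-cograph with distinguished vertex `v`, the level of a vertex records where it leaves
the path from `v` to the root of the cotree of its half, with one half counted negatively. In a
galled-tree, let `w` be a lowest vertex above all of `Y`. Either `Y` splits into two parts with `w`
as the only lowest common ancestor between them, or `Y` lies below a gall with source `w`; in the
latter case the level of a leaf records where the descent to it leaves the gall, with the leaves
below the hybrid-vertex on level zero. Galls are handled without choosing paths: a gall is given by
two children of its source and a highest common descendant `h` of them, and consists of everything
in between (`Digraph.IsGall`). This set is biconnected and contains `h` and both parents of `h`, so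
that galls with two common vertices have the same sink (`Digraph.IsGall.sink_eq`). From this follow
the uniqueness of lowest common ancestors, that the sides of a gall are chains, and that a gall can
be entered only through its source.

Finally, contractions that never create a red edge identify twins, so `0`-collapsible graphs are
exactly the cographs, and a primitive graph is not a cograph. This turns collapsibility into the
stated values of the twin-width (`SimpleGraph.twinWidth_eq_one_iff`).
-/

/-! ### Edge colourings and their contractions -/

namespace EdgeColouring

variable {V : Type*}

open Classical in
/-- The colour of a merged pair of edges: colours are `some True` (black), `some False`
(non-edge) and `none` (red), and merging different colours gives red. -/
noncomputable def mix (a b : Option Prop) : Option Prop := if a = b then a else none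

open Classical in
/-- The colouring after `v` has been contracted into `u`; the vertex `v` is to be discarded. -/
noncomputable def merge (c : V → V → Option Prop) (u v : V) : V → V → Option Prop :=
  fun x y => if x = u then mix (c u y) (c v y) else if y = u then mix (c x u) (c x v) else c x y

/-- The red neighbours of `x` in the vertex set `S`. -/
def redNbrs (c : V → V → Option Prop) (S : Set V) (x : V) : Set V :=
  {y | y ∈ S ∧ y ≠ x ∧ c x y = none}

/-- The trigraph with vertex set `S` and colouring `c` can be contracted to a single vertex
with all red degrees at most `d` throughout. Only the colours of distinct vertices of `S`
matter, and the vertex made from `u` and `v` inherits the name `u`. -/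
inductive Collapses (d : ℕ) : Set V → (V → V → Option Prop) → Prop
  | single (x : V) (c : V → V → Option Prop) : Collapses d {x} c
  | merge (S : Set V) (c : V → V → Option Prop) (u v : V) : u ∈ S → v ∈ S → u ≠ v →
      (∀ x ∈ S, (redNbrs c S x).ncard ≤ d) → Collapses d (S \ {v}) (merge c u v) →
      Collapses d S c

theorem mix_self (a : Option Prop) : mix a a = a := by simp [mix]

theorem mix_eq_none {a b : Option Prop} : mix a b = none ↔ a = none ∨ b = none ∨ a ≠ b := by
  unfold mix
  split_ifs with h
  · subst h; simp
  · simp [h]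

theorem mix_eq_some {a b : Option Prop} {p : Prop} :
    mix a b = some p ↔ a = some p ∧ b = some p := by
  unfold mix
  split_ifs with h
  · subst h; simp
  · constructor
    · simp
    · rintro ⟨h1, h2⟩; exact absurd (h1.trans h2.symm) h

theorem merge_left (c : V → V → Option Prop) (u v y : V) :
    merge c u v u y = mix (c u y) (c v y) := by simp [merge]

theorem merge_right (c : V → V → Option Prop) {u x : V} (v : V) (h : x ≠ u) :
    merge c u v x u = mix (c x u) (c x v) := by simp [merge, h]

theorem merge_of_ne (c : V → V → Option Prop) {u x y : V} (v : V) (hx : x ≠ u) (hy : y ≠ u) :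
    merge c u v x y = c x y := by simp [merge, hx, hy]

theorem merge_symm {c : V → V → Option Prop} (h : ∀ x y, c x y = c y x) (u v x y : V) :
    merge c u v x y = merge c u v y x := by
  by_cases hx : x = u
  · by_cases hy : y = u
    · rw [hx, hy]
    · rw [hx, merge_left, merge_right c v hy, h u y, h v y]
  · by_cases hy : y = u
    · rw [hy, merge_left, merge_right c v hx, h u x, h v x]
    · rw [merge_of_ne c v hx hy, merge_of_ne c v hy hx, h]

theorem Collapses.nonempty {d : ℕ} {S : Set V} {c : V → V → Option Prop}
    (h : Collapses d S c) : S.Nonempty := by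
  cases h with
  | single x => exact Set.singleton_nonempty x
  | merge _ _ u v hu => exact ⟨u, hu⟩

theorem Collapses.ncard_redNbrs_le {d : ℕ} {S : Set V} {c : V → V → Option Prop}
    (h : Collapses d S c) : ∀ x ∈ S, (redNbrs c S x).ncard ≤ d := by
  cases h with
  | single x =>
    intro y hy
    have : redNbrs c {x} y = ∅ := by
      ext z
      simp only [redNbrs, Set.mem_ofPred_eq, Set.mem_empty_iff_false, iff_false]
      rintro ⟨rfl, h2, -⟩
      exact h2 hy.symm
    simp [this]
  | merge _ _ u v _ _ _ hd => exact hd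

/-- Turning red pairs into edges or non-edges keeps a trigraph collapsible. -/
theorem Collapses.mono [Finite V] {d : ℕ} {S : Set V} {c c' : V → V → Option Prop}
    (h : Collapses d S c)
    (hc : ∀ x ∈ S, ∀ y ∈ S, x ≠ y → c x y = none ∨ c' x y = c x y) : Collapses d S c' := by
  induction h generalizing c' with
  | single x => exact .single x c'
  | merge S c u v hu hv huv hd _ ih =>
    refine .merge S c' u v hu hv huv (fun x hx => ?_) (ih fun x hx y hy hxy => ?_)
    · refine (Set.ncard_le_ncard ?_ (Set.toFinite _)).trans (hd x hx)
      rintro y ⟨hy, hyx, h⟩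
      refine ⟨hy, hyx, ?_⟩
      rcases hc x hx y hy hyx.symm with h' | h'
      · exact h'
      · rw [← h', h]
    · have key : ∀ a b a' b' : Option Prop, (a = none ∨ a' = a) → (b = none ∨ b' = b) →
          mix a b = none ∨ mix a' b' = mix a b := by
        rintro a b a' b' (rfl | rfl) (rfl | rfl) <;> simp [mix_eq_none]
      by_cases hxu : x = u
      · subst hxu
        rw [merge_left, merge_left]
        exact key _ _ _ _ (hc _ hu _ hy.1 hxy) (hc _ hv _ hy.1 (Ne.symm hy.2))
      · by_cases hyu : y = u
        · subst hyu
          rw [merge_right _ _ hxu, merge_right _ _ hxu]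
          exact key _ _ _ _ (hc _ hx.1 _ hu hxy) (hc _ hx.1 _ hv hx.2)
        · rw [merge_of_ne _ _ hxu hyu, merge_of_ne _ _ hxu hyu]
          exact hc x hx.1 y hy.1 hxy

/-- A module `M` without red edges to the outside may be collapsed first, leaving one of its
vertices as a representative. -/
theorem Collapses.of_module [Finite V] {d : ℕ} {M Y : Set V} {c : V → V → Option Prop}
    (h : Collapses d M c) (hMY : M ⊆ Y)
    (hmod : ∀ x ∈ Y \ M, ∃ k : Prop, ∀ m ∈ M, c m x = some k ∧ c x m = some k)
    (hrest : ∀ r ∈ M, Collapses d (insert r (Y \ M)) c) : Collapses d Y c := by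
  induction h generalizing Y with
  | single x c =>
    have := hrest x rfl
    rwa [Set.insert_sdiff_singleton, Set.insert_eq_of_mem (hMY rfl)] at this
  | merge M c u v hu hv huv hd _ ih =>
    have hYM : (Y \ {v}) \ (M \ {v}) = Y \ M := by
      ext x
      simp only [Set.mem_sdiff, Set.mem_singleton_iff]
      constructor
      · rintro ⟨⟨h1, h2⟩, h3⟩; exact ⟨h1, fun h => h3 ⟨h, h2⟩⟩
      · rintro ⟨h1, h2⟩; exact ⟨⟨h1, fun h => h2 (h ▸ hv)⟩, fun h => h2 h.1⟩
    refine .merge Y c u v (hMY hu) (hMY hv) huv (fun x hx => ?_)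
      (ih (Set.sdiff_subset_sdiff_left hMY) ?_ ?_)
    · by_cases hxM : x ∈ M
      · refine (Set.ncard_le_ncard ?_ (Set.toFinite _)).trans (hd x hxM)
        rintro y ⟨hy, hyx, h⟩
        refine ⟨?_, hyx, h⟩
        by_contra hyM
        obtain ⟨k, hk⟩ := hmod y ⟨hy, hyM⟩
        simp [(hk x hxM).1] at h
      · refine (Set.ncard_le_ncard ?_ (Set.toFinite _)).trans
          ((hrest u hu).ncard_redNbrs_le x (Or.inr ⟨hx, hxM⟩))
        rintro y ⟨hy, hyx, h⟩
        refine ⟨Or.inr ⟨hy, fun hyM => ?_⟩, hyx, h⟩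
        obtain ⟨k, hk⟩ := hmod x ⟨hx, hxM⟩
        simp [(hk y hyM).2] at h
    · rw [hYM]
      intro x hx
      obtain ⟨k, hk⟩ := hmod x hx
      refine ⟨k, fun m hm => ?_⟩
      have hxu : x ≠ u := fun h => hx.2 (h ▸ hu)
      by_cases hmu : m = u
      · subst hmu
        rw [merge_left, merge_right _ _ hxu, (hk m hu).1, (hk m hu).2, (hk v hv).1,
          (hk v hv).2, mix_self]
        exact ⟨rfl, rfl⟩
      · rw [merge_of_ne _ _ hmu hxu, merge_of_ne _ _ hxu hmu]
        exact hk m hm.1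
    · rw [hYM]
      intro r hr
      refine (hrest r hr.1).mono fun x hx y hy hxy => Or.inr ?_
      by_cases hxu : x = u
      · subst hxu
        have hy' : y ∈ Y \ M := by
          rcases hy with rfl | hy
          · rcases hx with rfl | hx
            · exact absurd rfl hxy
            · exact absurd hu hx.2
          · exact hy
        obtain ⟨k, hk⟩ := hmod y hy'
        rw [merge_left, (hk x hu).1, (hk v hv).1, mix_self]
      · by_cases hyu : y = u
        · subst hyu
          have hx' : x ∈ Y \ M := by
            rcases hx with rfl | hx
            · rcases hy with rfl | hy
              · exact absurd rfl hxy
              · exact absurd hu hy.2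
            · exact hx
          obtain ⟨k, hk⟩ := hmod x hx'
          rw [merge_right _ _ hxu, (hk y hu).2, (hk v hv).2, mix_self]
        · rw [merge_of_ne _ _ hxu hyu]

/-- The trigraph with vertex set `S` whose edges are coloured by `c`. -/
def toTrigraph (S : Set V) (c : V → V → Option Prop) (hc : ∀ x y, c x y = c y x) :
    Trigraph V where
  verts := S
  black :=
    { Adj := fun x y => x ≠ y ∧ x ∈ S ∧ y ∈ S ∧ c x y = some True
      symm := ⟨fun x y h => ⟨h.1.symm, h.2.2.1, h.2.1, by rw [hc]; exact h.2.2.2⟩⟩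
      loopless := ⟨fun _ h => h.1 rfl⟩ }
  red :=
    { Adj := fun x y => x ≠ y ∧ x ∈ S ∧ y ∈ S ∧ c x y = none
      symm := ⟨fun x y h => ⟨h.1.symm, h.2.2.1, h.2.1, by rw [hc]; exact h.2.2.2⟩⟩
      loopless := ⟨fun _ h => h.1 rfl⟩ }
  black_mem := fun h => ⟨h.2.1, h.2.2.1⟩
  red_mem := fun h => ⟨h.2.1, h.2.2.1⟩
  disjoint := by
    rw [SimpleGraph.disjoint_left]
    intro x y h h'
    have := h.2.2.2.symm.trans h'.2.2.2
    simp at this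

/-- `T` is the trigraph with vertex set `S` and colouring `c`. -/
def Colours (c : V → V → Option Prop) (S : Set V) (T : Trigraph V) : Prop :=
  T.verts = S ∧ ∀ x ∈ S, ∀ y ∈ S, x ≠ y →
    (T.black.Adj x y ↔ c x y = some True) ∧ (T.red.Adj x y ↔ c x y = none)

theorem colours_toTrigraph (S : Set V) (c : V → V → Option Prop) (hc : ∀ x y, c x y = c y x) :
    Colours c S (toTrigraph S c hc) :=
  ⟨rfl, fun x hx y hy hxy =>
    ⟨by simp [toTrigraph, hx, hy, hxy], by simp [toTrigraph, hx, hy, hxy]⟩⟩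

theorem Colours.isDTrigraph {d : ℕ} {c : V → V → Option Prop} {S : Set V} {T : Trigraph V}
    (h : Colours c S T) (hd : ∀ x ∈ S, (redNbrs c S x).ncard ≤ d) : T.IsDTrigraph d := by
  intro x hx
  rw [h.1] at hx
  have : T.red.neighborSet x = redNbrs c S x := by
    ext y
    simp only [SimpleGraph.mem_neighborSet, redNbrs, Set.mem_ofPred_eq]
    constructor
    · intro hxy
      have hy : y ∈ S := h.1 ▸ (T.red_mem hxy).2
      exact ⟨hy, hxy.ne.symm, ((h.2 x hx y hy hxy.ne).2).1 hxy⟩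
    · rintro ⟨hy, hyx, hxy⟩
      exact ((h.2 x hx y hy hyx.symm).2).2 hxy
  rw [this]
  exact hd x hx

theorem Colours.isContractionOf {c : V → V → Option Prop} {S : Set V} {T T' : Trigraph V}
    {u v : V} (h : Colours c S T) (hu : u ∈ S) (hv : v ∈ S)
    (huv : u ≠ v) (h' : Colours (merge c u v) (S \ {v}) T') : T'.IsContractionOf T u v u := by
  have hS := h.1
  have hrest : ∀ x ∈ T.verts \ {u, v}, x ∈ S ∧ x ≠ u ∧ x ≠ v := by
    rintro x ⟨hx, hx'⟩
    simp only [Set.mem_insert_iff, Set.mem_singleton_iff, not_or] at hx'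
    exact ⟨hS ▸ hx, hx'⟩
  have hold : ∀ x ∈ T.verts \ {u, v}, ∀ y ∈ T.verts \ {u, v},
      (T'.black.Adj x y ↔ T.black.Adj x y) ∧ (T'.red.Adj x y ↔ T.red.Adj x y) := by
    intro x hx y hy
    by_cases hxy : x = y
    · subst hxy; simp
    obtain ⟨hx1, hx2, hx3⟩ := hrest x hx
    obtain ⟨hy1, hy2, hy3⟩ := hrest y hy
    have e1 := h.2 x hx1 y hy1 hxy
    have e2 := h'.2 x ⟨hx1, hx3⟩ y ⟨hy1, hy3⟩ hxy
    rw [merge_of_ne _ _ hx2 hy2] at e2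
    exact ⟨e2.1.trans e1.1.symm, e2.2.trans e1.2.symm⟩
  have hnew : ∀ x ∈ T.verts \ {u, v},
      (T'.black.Adj u x ↔ mix (c u x) (c v x) = some True) ∧
      (T'.red.Adj u x ↔ mix (c u x) (c v x) = none) := by
    intro x hx
    obtain ⟨hx1, hx2, hx3⟩ := hrest x hx
    have e2 := h'.2 u ⟨hu, huv⟩ x ⟨hx1, hx3⟩ (Ne.symm hx2)
    rwa [merge_left] at e2
  have hnonadj : ∀ a : Option Prop, ¬ (a = some True ∨ a = none) ↔ a = some False := by
    rintro (_ | p)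
    · simp
    · by_cases hp : p <;> simp [hp]
  refine ⟨hS ▸ hu, hS ▸ hv, huv, fun hmem => hmem.2 (Or.inl rfl), ?_,
    fun x hx y hy => (hold x hx y hy).1, fun x hx y hy => (hold x hx y hy).2, ?_, ?_⟩
  · rw [h'.1, hS]
    ext x
    simp only [Set.mem_sdiff, Set.mem_singleton_iff, Set.mem_insert_iff, not_or]
    constructor
    · rintro ⟨h1, h2⟩
      by_cases hxu : x = u
      · exact Or.inl hxu
      · exact Or.inr ⟨h1, hxu, h2⟩
    · rintro (rfl | ⟨h1, -, h2⟩)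
      · exact ⟨hu, huv⟩
      · exact ⟨h1, h2⟩
  · intro x hx
    obtain ⟨hx1, hx2, hx3⟩ := hrest x hx
    rw [(hnew x hx).1, mix_eq_some, (h.2 u hu x hx1 (Ne.symm hx2)).1,
      (h.2 v hv x hx1 (Ne.symm hx3)).1]
  · intro x hx
    obtain ⟨hx1, hx2, hx3⟩ := hrest x hx
    rw [(hnew x hx).1, (hnew x hx).2, (h.2 u hu x hx1 (Ne.symm hx2)).1,
      (h.2 v hv x hx1 (Ne.symm hx3)).1, (h.2 u hu x hx1 (Ne.symm hx2)).2,
      (h.2 v hv x hx1 (Ne.symm hx3)).2, hnonadj, hnonadj, hnonadj, mix_eq_some]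

theorem Collapses.isCollapsible [Finite V] {d : ℕ} {S : Set V} {c : V → V → Option Prop}
    (h : Collapses d S c) (hc : ∀ x y, c x y = c y x) {T : Trigraph V} (hT : Colours c S T) :
    T.IsCollapsible d := by
  induction h generalizing T with
  | single x c =>
    have h1 : T.verts.ncard = 1 := by rw [hT.1, Set.ncard_singleton]
    refine ⟨fun _ => T, rfl, fun i _ _ =>
      hT.isDTrigraph (Collapses.single (d := d) x c).ncard_redNbrs_le, ?_, x, hT.1⟩
    intro i hi hi'
    omega
  | merge S c u v hu hv huv hd _ ih =>
    have hc' := merge_symm hc u v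
    have hT' := colours_toTrigraph (S \ {v}) (EdgeColouring.merge c u v) hc'
    obtain ⟨F, hF, hFd, hFc, hF1⟩ := ih hc' hT'
    have hcard : T.verts.ncard = (S \ {v}).ncard + 1 := by
      rw [hT.1, Set.ncard_sdiff_singleton_add_one hv (Set.toFinite _)]
    have hpos : 0 < (S \ {v}).ncard := (Set.ncard_pos (Set.toFinite _)).2 ⟨u, hu, huv⟩
    have hverts : (toTrigraph (S \ {v}) (EdgeColouring.merge c u v) hc').verts = S \ {v} := rfl
    rw [hverts] at hF hFd hFc
    refine ⟨fun i => if i = T.verts.ncard then T else F i, by simp, ?_, ?_, ?_⟩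
    · intro i hi hi'
      by_cases h : i = T.verts.ncard
      · simp only [h, if_true]
        exact hT.isDTrigraph hd
      · simp only [h, if_false]
        exact hFd i hi (by omega)
    · intro i hi hi'
      have h : i ≠ T.verts.ncard := by omega
      simp only [h, if_false]
      by_cases h2 : i + 1 = T.verts.ncard
      · simp only [h2, if_true]
        have : i = (S \ {v}).ncard := by omega
        rw [this, hF]
        exact ⟨u, v, u, hT.isContractionOf hu hv huv hT'⟩
      · simp only [h2, if_false]
        exact hFc i hi (by omega)
    · have h : 1 ≠ T.verts.ncard := by omega
      simp only [h, if_false]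
      exact hF1

end EdgeColouring

namespace SimpleGraph

open EdgeColouring

variable {V : Type*}

/-- The colouring of a graph, without red edges. -/
def colour (G : SimpleGraph V) : V → V → Option Prop := fun x y => some (G.Adj x y)

theorem colour_symm (G : SimpleGraph V) (x y : V) : G.colour x y = G.colour y x := by
  simp [colour, G.adj_comm]

theorem isCollapsible_of_collapses [Finite V] {d : ℕ} {G : SimpleGraph V}
    (h : Collapses d Set.univ G.colour) : G.IsCollapsible d :=
  h.isCollapsible G.colour_symm
    ⟨rfl, fun x _ y _ _ => ⟨by simp [toTrigraph, colour], by simp [toTrigraph, colour]⟩⟩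

theorem ncard_redNbrs_colour (G : SimpleGraph V) (S : Set V) (x : V) :
    (redNbrs G.colour S x).ncard = 0 := by
  have : redNbrs G.colour S x = ∅ := by ext y; simp [redNbrs, colour]
  rw [this, Set.ncard_empty]

theorem collapses_of_module [Finite V] {d : ℕ} {G : SimpleGraph V} {M Y : Set V}
    (h : Collapses d M G.colour) (hMY : M ⊆ Y)
    (hmod : ∀ x ∈ Y \ M, ∀ m ∈ M, ∀ m' ∈ M, G.Adj m x → G.Adj m' x)
    (hrest : ∀ r ∈ M, Collapses d (insert r (Y \ M)) G.colour) : Collapses d Y G.colour := by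
  refine h.of_module hMY (fun x hx => ?_) hrest
  obtain ⟨m, hm⟩ := h.nonempty
  refine ⟨G.Adj m x, fun m' hm' => ?_⟩
  have : G.Adj m' x = G.Adj m x :=
    propext ⟨hmod x hx m' hm' m hm, hmod x hx m hm m' hm'⟩
  rw [G.colour_symm x m']
  simp [colour, this]

theorem collapses_union [Finite V] {d : ℕ} {G : SimpleGraph V} {A B : Set V} {k : Prop}
    (hA : Collapses d A G.colour) (hB : Collapses d B G.colour) (hAB : Disjoint A B)
    (hk : ∀ a ∈ A, ∀ b ∈ B, (G.Adj a b ↔ k)) : Collapses d (A ∪ B) G.colour := by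
  refine collapses_of_module hA Set.subset_union_left ?_ fun a ha => ?_
  · rintro x ⟨hx | hx, hx'⟩ m hm m' hm' h
    · exact absurd hx hx'
    · exact (hk m' hm' x hx).2 ((hk m hm x hx).1 h)
  · rw [Set.union_sdiff_left, sdiff_eq_left.2 hAB.symm]
    have haB : a ∉ B := Set.disjoint_left.1 hAB ha
    refine collapses_of_module hB (Set.subset_insert _ _) ?_ fun b hb => ?_
    · rintro x ⟨rfl | hx, hx'⟩ m hm m' hm' h
      · exact ((hk x ha m' hm').2 ((hk x ha m hm).1 h.symm)).symm
      · exact absurd hx hx'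
    · have hab : a ≠ b := fun h => haB (h ▸ hb)
      have h1 : insert b (insert a B \ B) = {b, a} := by
        ext x
        simp only [Set.mem_insert_iff, Set.mem_sdiff, Set.mem_singleton_iff]
        constructor
        · rintro (h | ⟨h | h, h'⟩)
          · exact Or.inl h
          · exact Or.inr h
          · exact absurd h h'
        · rintro (h | rfl)
          · exact Or.inl h
          · exact Or.inr ⟨Or.inl rfl, haB⟩
      rw [h1]
      refine .merge _ _ b a (Or.inl rfl) (Or.inr rfl) hab.symm
        (fun x _ => by rw [ncard_redNbrs_colour]; exact Nat.zero_le _) ?_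
      have h2 : ({b, a} : Set V) \ {a} = {b} := by
        ext x
        simp only [Set.mem_insert_iff, Set.mem_sdiff, Set.mem_singleton_iff]
        constructor
        · rintro ⟨h | h, h'⟩
          · exact h
          · exact absurd h h'
        · rintro rfl; exact ⟨Or.inl rfl, hab.symm⟩
      rw [h2]
      exact .single b _

/-! ### Twin-width zero -/

theorem IsCographOn.nonempty {G : SimpleGraph V} {A : Set V} (h : G.IsCographOn A) :
    A.Nonempty := by
  induction h with
  | single x => exact Set.singleton_nonempty x
  | disjointUnion A B _ _ _ _ ihA _ => exact ihA.inl
  | join A B _ _ _ _ ihA _ => exact ihA.inl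

theorem IsCographOn.collapses [Finite V] {G : SimpleGraph V} {A : Set V}
    (h : G.IsCographOn A) (d : ℕ) : Collapses d A G.colour := by
  induction h with
  | single x => exact .single x _
  | disjointUnion A B _ _ hAB h ihA ihB =>
    exact collapses_union (k := False) ihA ihB hAB (by simpa using h)
  | join A B _ _ hAB h ihA ihB =>
    exact collapses_union (k := True) ihA ihB hAB (by simpa using h)

/-- Blowing up the vertices of a cograph into cographs gives a cograph. -/
theorem IsCographOn.preimage {G G' : SimpleGraph V} {A B : Set V} (h : G'.IsCographOn A)
    (π : V → V) (hfib : ∀ x ∈ A, G.IsCographOn (π ⁻¹' {x} ∩ B))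
    (hadj : ∀ x ∈ B, ∀ y ∈ B, π x ≠ π y → (G.Adj x y ↔ G'.Adj (π x) (π y))) :
    G.IsCographOn (π ⁻¹' A ∩ B) := by
  induction h with
  | single x => exact hfib x rfl
  | disjointUnion A A' _ _ hd h ih ih' =>
    rw [Set.preimage_union, Set.union_inter_distrib_right]
    refine .disjointUnion _ _ (ih fun x hx => hfib x (Or.inl hx))
      (ih' fun x hx => hfib x (Or.inr hx)) ?_ ?_
    · exact ((hd.preimage π).inter_left _).inter_right _
    · rintro a ⟨ha, haB⟩ b ⟨hb, hbB⟩
      rw [hadj a haB b hbB (hd.ne_of_mem ha hb)]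
      exact h _ ha _ hb
  | join A A' _ _ hd h ih ih' =>
    rw [Set.preimage_union, Set.union_inter_distrib_right]
    refine .join _ _ (ih fun x hx => hfib x (Or.inl hx))
      (ih' fun x hx => hfib x (Or.inr hx)) ?_ ?_
    · exact ((hd.preimage π).inter_left _).inter_right _
    · rintro a ⟨ha, haB⟩ b ⟨hb, hbB⟩
      rw [hadj a haB b hbB (hd.ne_of_mem ha hb)]
      exact h _ ha _ hb

theorem isCographOn_pair (G : SimpleGraph V) {u v : V} (h : u ≠ v) :
    G.IsCographOn {u, v} := by
  rw [← Set.singleton_union]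
  by_cases huv : G.Adj u v
  · exact .join _ _ (.single u) (.single v) (by simpa using h) (by simpa using huv)
  · exact .disjointUnion _ _ (.single u) (.single v) (by simpa using h) (by simpa using huv)

/-- Undoing a contraction that creates no red edge replaces a vertex by two twins. -/
theorem isCographOn_of_contraction {T T' : Trigraph V} {u v w : V}
    (h : T'.IsContractionOf T u v w) (hr : ∀ x y, ¬ T.red.Adj x y)
    (hr' : ∀ x y, ¬ T'.red.Adj x y) (hc : T'.black.IsCographOn T'.verts) :
    T.black.IsCographOn T.verts := by
  classical
  -- `π` maps the vertices of `T` to those of `T'`; its fibre over `w` is `{u, v}`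
  let π : V → V := fun x => if x = u ∨ x = v then w else x
  have hπ1 : ∀ x, (x = u ∨ x = v) → π x = w := fun x hx => if_pos hx
  have hπ2 : ∀ x, ¬ (x = u ∨ x = v) → π x = x := fun x hx => if_neg hx
  have hmem : ∀ x ∈ T.verts, ¬ (x = u ∨ x = v) → x ∈ T.verts \ {u, v} :=
    fun x hx hx' => ⟨hx, by simpa using hx'⟩
  have hnew : ∀ a ∈ T.verts, (a = u ∨ a = v) → ∀ x ∈ T.verts, ¬ (x = u ∨ x = v) →
      (T.black.Adj a x ↔ T'.black.Adj w x) := by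
    intro a _ ha' x hx hx'
    have e1 := h.black_new x (hmem x hx hx')
    have e2 := h.nonadj_new x (hmem x hx hx')
    simp only [hr, hr', or_false] at e2
    rcases ha' with rfl | rfl <;> tauto
  have main := hc.preimage (G := T.black) (B := T.verts) π ?_ ?_
  · have : π ⁻¹' T'.verts ∩ T.verts = T.verts := by
      refine Set.inter_eq_right.2 fun x hx => ?_
      rw [Set.mem_preimage, h.verts_eq]
      by_cases hx' : x = u ∨ x = v
      · rw [hπ1 x hx']; exact Or.inl rfl
      · rw [hπ2 x hx']; exact Or.inr (hmem x hx hx')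
    rwa [this] at main
  · intro x hx
    rw [h.verts_eq] at hx
    by_cases hxw : x = w
    · have : π ⁻¹' {x} ∩ T.verts = {u, v} := by
        ext y
        simp only [Set.mem_inter_iff, Set.mem_preimage, Set.mem_singleton_iff,
          Set.mem_insert_iff]
        constructor
        · rintro ⟨h1, h2⟩
          by_contra hy
          rw [hπ2 y hy, hxw] at h1
          exact h.fresh (h1 ▸ hmem y h2 hy)
        · intro hy
          refine ⟨(hπ1 y hy).trans hxw.symm, ?_⟩
          rcases hy with rfl | rfl
          · exact h.left_mem
          · exact h.right_mem
      rw [this]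
      exact isCographOn_pair _ h.ne
    · have hx' := hx.resolve_left hxw
      have hx2 : ¬ (x = u ∨ x = v) := by simpa using hx'.2
      have : π ⁻¹' {x} ∩ T.verts = {x} := by
        ext y
        simp only [Set.mem_inter_iff, Set.mem_preimage, Set.mem_singleton_iff]
        constructor
        · rintro ⟨h1, h2⟩
          by_cases hy : y = u ∨ y = v
          · exact absurd ((hπ1 y hy).symm.trans h1).symm hxw
          · rwa [hπ2 y hy] at h1
        · rintro rfl
          exact ⟨hπ2 y hx2, hx'.1⟩
      rw [this]
      exact .single x
  · intro x hx y hy hxy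
    by_cases hx' : x = u ∨ x = v <;> by_cases hy' : y = u ∨ y = v
    · exact absurd ((hπ1 x hx').trans (hπ1 y hy').symm) hxy
    · rw [hπ1 x hx', hπ2 y hy']
      exact hnew x hx hx' y hy hy'
    · rw [hπ1 y hy', hπ2 x hx', T.black.adj_comm, T'.black.adj_comm]
      exact hnew y hy hy' x hx hx'
    · rw [hπ2 x hx', hπ2 y hy']
      exact (h.black_rest x (hmem x hx hx') y (hmem y hy hy')).symm

theorem isCograph_of_isCollapsible_zero [Finite V] [Nonempty V] {G : SimpleGraph V}
    (h : G.IsCollapsible 0) : G.IsCograph := by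
  obtain ⟨S, hS, hd, hc, x, hx⟩ := h
  have hpos : 0 < G.toTrigraph.verts.ncard :=
    (Set.ncard_pos (Set.toFinite _)).2 Set.univ_nonempty
  have hred : ∀ i, 1 ≤ i → i ≤ G.toTrigraph.verts.ncard →
      ∀ x y, ¬ (S i).red.Adj x y := by
    intro i hi hi' x y hxy
    have := hd i hi hi' x ((S i).red_mem hxy).1
    rw [Nat.le_zero, Set.ncard_eq_zero (Set.toFinite _)] at this
    exact Set.notMem_empty y (this ▸ hxy)
  have key : ∀ i, 1 ≤ i → i ≤ G.toTrigraph.verts.ncard →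
      (S i).black.IsCographOn (S i).verts := by
    intro i hi
    induction i, hi using Nat.le_induction with
    | base => intro _; rw [hx]; exact .single x
    | succ i hi ih =>
      intro hi'
      obtain ⟨u, v, w, huvw⟩ := hc i hi (by omega)
      exact isCographOn_of_contraction huvw (hred _ (by omega) hi')
        (hred i hi (by omega)) (ih (by omega))
  have := key _ hpos le_rfl
  rw [hS] at this
  exact this

theorem twinWidth_eq_one_iff [Finite V] [Nonempty V] {G : SimpleGraph V}
    (h : G.IsCollapsible 1) : G.twinWidth = 1 ↔ ¬ G.IsCograph := by
  have hle : G.twinWidth ≤ 1 := Nat.sInf_le h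
  constructor
  · intro h1 hco
    have : G.twinWidth ≤ 0 := Nat.sInf_le (isCollapsible_of_collapses (hco.collapses 0))
    omega
  · intro hco
    -- the infimum is attained, as the set of admissible `d` contains `1`
    have : G.twinWidth ≠ 0 := fun h0 => hco <| isCograph_of_isCollapsible_zero <| by
      have hm : G.twinWidth ∈ {d | G.IsCollapsible d} := Nat.sInf_mem ⟨1, h⟩
      rwa [h0] at hm
    omega

/-- A cograph with at least two vertices is split into two parts joined completely or not at
all, and the same holds for each of its induced subgraphs. -/
theorem IsCographOn.exists_split {G : SimpleGraph V} {A Y : Set V} (h : G.IsCographOn A)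
    (hYA : Y ⊆ A) (hY : Y.Nontrivial) : ∃ (Z : Set V) (k : Prop), (Y ∩ Z).Nonempty ∧
      (Y \ Z).Nonempty ∧ ∀ a ∈ Y ∩ Z, ∀ b ∈ Y \ Z, (G.Adj a b ↔ k) := by
  have step : ∀ (A B : Set V) (k : Prop), Disjoint A B → Y ⊆ A ∪ B →
      (∀ a ∈ A, ∀ b ∈ B, (G.Adj a b ↔ k)) → (Y ⊆ A ∨ Y ⊆ B) ∨
      ∃ (Z : Set V) (k : Prop), (Y ∩ Z).Nonempty ∧
      (Y \ Z).Nonempty ∧ ∀ a ∈ Y ∩ Z, ∀ b ∈ Y \ Z, (G.Adj a b ↔ k) := by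
    intro A B k _ hY hk
    by_cases hA : Y ⊆ A
    · exact Or.inl (Or.inl hA)
    by_cases hB : Y ⊆ B
    · exact Or.inl (Or.inr hB)
    obtain ⟨x, hx, hxA⟩ := Set.not_subset.1 hA
    obtain ⟨y, hy, hyB⟩ := Set.not_subset.1 hB
    exact Or.inr ⟨A, k, ⟨y, hy, (hY hy).resolve_right hyB⟩, ⟨x, hx, hxA⟩,
      fun a ha b hb => hk a ha.2 b ((hY hb.1).resolve_left hb.2)⟩
  induction h with
  | single x => exact absurd (Set.subsingleton_singleton.anti hYA) hY.not_subsingleton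
  | disjointUnion A B _ _ hAB h ihA ihB =>
    rcases step A B False hAB hYA (by simpa using h) with (h | h) | h
    exacts [ihA h, ihB h, h]
  | join A B _ _ hAB h ihA ihB =>
    rcases step A B True hAB hYA (by simpa using h) with (h | h) | h
    exacts [ihA h, ihB h, h]

theorem IsPrimitive.not_isCograph [Finite V] {G : SimpleGraph V} (h : G.IsPrimitive) :
    ¬ G.IsCograph := by
  intro hco
  obtain ⟨hcard, hmod⟩ := h
  have hnt : (Set.univ : Set V).Nontrivial := by
    rw [← Set.one_lt_ncard_iff_nontrivial, Set.ncard_univ]; omega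
  obtain ⟨Z, k, h1, h2, hk⟩ := IsCographOn.exists_split hco Set.Subset.rfl hnt
  simp only [Set.univ_inter, Set.mem_sdiff, Set.mem_univ, true_and] at h1 h2 hk
  have key : ∀ M : Set V, M.Nonempty → Mᶜ.Nonempty →
      (∀ a ∈ M, ∀ b ∉ M, (G.Adj a b ↔ k)) → M.ncard = 1 := by
    intro M hM hM' hk
    have hmodM : G.IsModule M := by
      intro x hx y hy
      ext z
      simp only [Set.mem_sdiff, mem_neighborSet]
      constructor
      · rintro ⟨h, hz⟩; exact ⟨(hk y hy z hz).2 ((hk x hx z hz).1 h), hz⟩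
      · rintro ⟨h, hz⟩; exact ⟨(hk x hx z hz).2 ((hk y hy z hz).1 h), hz⟩
    rcases hmod M hM hmodM with ⟨x, rfl⟩ | rfl
    · exact Set.ncard_singleton x
    · simp at hM'
  have e1 := key Z h1 (by obtain ⟨x, hx⟩ := h2; exact ⟨x, hx.2⟩) hk
  have e2 := key Zᶜ (by obtain ⟨x, hx⟩ := h2; exact ⟨x, hx.2⟩) (by rwa [compl_compl])
    (fun a ha b hb => by rw [G.adj_comm]; exact hk b (by simpa using hb) a ha)
  have := Set.ncard_add_ncard_compl Z (Set.toFinite _) (Set.toFinite _)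
  omega

end SimpleGraph

namespace SimpleGraph

open EdgeColouring

variable {V : Type*}

/-! ### Polar labelings -/

/-- A polar labeling of the vertex set `Y`. The level sets of `f` are modules; the positive and
the negative levels form two caterpillars that hang off level zero, the outermost levels being
those of largest absolute value. A vertex of level `i` is adjacent to all or to none of the
vertices closer to zero on its side, according to `l i`, and `k` tells whether the two sides are
joined. -/
structure IsPolarLabeling (G : SimpleGraph V) (Y : Set V) (f : V → ℤ) (l : ℤ → Prop)
    (k : Prop) : Prop where
  exists_zero : ∃ v ∈ Y, f v = 0
  exists_ne_zero : ∃ a ∈ Y, f a ≠ 0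
  adj_of_pos : ∀ x ∈ Y, ∀ y ∈ Y, 0 ≤ f y → f y < f x → (G.Adj x y ↔ l (f x))
  adj_of_neg : ∀ x ∈ Y, ∀ y ∈ Y, f x < f y → f y ≤ 0 → (G.Adj x y ↔ l (f x))
  adj_across : ∀ x ∈ Y, ∀ y ∈ Y, f x < 0 → 0 < f y → (G.Adj x y ↔ k)

/-- `Y` has a polar labeling in `G`. -/
def HasPolarLabeling (G : SimpleGraph V) (Y : Set V) : Prop :=
  ∃ f l k, G.IsPolarLabeling Y f l k

variable {G : SimpleGraph V} {Y : Set V} {f : V → ℤ} {l : ℤ → Prop} {k : Prop}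

theorem IsPolarLabeling.neg (h : G.IsPolarLabeling Y f l k) :
    G.IsPolarLabeling Y (fun x => - f x) (fun i => l (-i)) k where
  exists_zero := by
    obtain ⟨v, hv, hv0⟩ := h.exists_zero
    exact ⟨v, hv, by omega⟩
  exists_ne_zero := by
    obtain ⟨v, hv, hv0⟩ := h.exists_ne_zero
    exact ⟨v, hv, by omega⟩
  adj_of_pos x hx y hy h1 h2 := by
    rw [neg_neg]; exact h.adj_of_neg x hx y hy (by omega) (by omega)
  adj_of_neg x hx y hy h1 h2 := by
    rw [neg_neg]; exact h.adj_of_pos x hx y hy (by omega) (by omega)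
  adj_across x hx y hy h1 h2 := by
    rw [G.adj_comm]; exact h.adj_across y hy x hx (by omega) (by omega)

theorem HasPolarLabeling.of_split {Z : Set V} (h1 : (Y ∩ Z).Nonempty) (h2 : (Y \ Z).Nonempty)
    (hk : ∀ a ∈ Y ∩ Z, ∀ b ∈ Y \ Z, (G.Adj a b ↔ k)) : G.HasPolarLabeling Y := by
  classical
  have e1 : ∀ x, x ∈ Z → (if x ∈ Z then (1 : ℤ) else 0) = 1 := fun x hx => if_pos hx
  have e2 : ∀ x, x ∉ Z → (if x ∈ Z then (1 : ℤ) else 0) = 0 := fun x hx => if_neg hx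
  refine ⟨fun x => if x ∈ Z then 1 else 0, fun _ => k, k, ?_, ?_, ?_, ?_, ?_⟩
  · obtain ⟨x, hx, hx'⟩ := h2
    exact ⟨x, hx, e2 x hx'⟩
  · obtain ⟨x, hx, hx'⟩ := h1
    exact ⟨x, hx, by simp [e1 x hx']⟩
  · intro x hx y hy h3 h4
    by_cases hxZ : x ∈ Z <;> by_cases hyZ : y ∈ Z <;> simp [hxZ, hyZ] at h4
    exact hk x ⟨hx, hxZ⟩ y ⟨hy, hyZ⟩
  · intro x hx y hy h3 h4
    by_cases hxZ : x ∈ Z <;> by_cases hyZ : y ∈ Z <;> simp [hxZ, hyZ] at h3 h4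
  · intro x hx y hy h3 h4
    by_cases hxZ : x ∈ Z <;> by_cases hyZ : y ∈ Z <;> simp [hxZ] at h3 h4

theorem IsPolarLabeling.adj_iff_of_eq (h : G.IsPolarLabeling Y f l k) {m m' x : V}
    (hm : m ∈ Y) (hm' : m' ∈ Y) (hx : x ∈ Y) (he : f m = f m') (hne : f x ≠ f m) :
    G.Adj m x ↔ G.Adj m' x := by
  rcases lt_or_gt_of_ne hne with h1 | h1
  · rcases le_or_gt 0 (f x) with h2 | h2
    · rw [h.adj_of_pos m hm x hx h2 h1, h.adj_of_pos m' hm' x hx h2 (by omega), he]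
    · rcases le_or_gt (f m) 0 with h3 | h3
      · rw [G.adj_comm m, G.adj_comm m', h.adj_of_neg x hx m hm h1 h3,
          h.adj_of_neg x hx m' hm' (by omega) (by omega)]
      · rw [G.adj_comm m, G.adj_comm m', h.adj_across x hx m hm h2 h3,
          h.adj_across x hx m' hm' (by omega) (by omega)]
  · rcases le_or_gt (f x) 0 with h2 | h2
    · rw [h.adj_of_neg m hm x hx h1 h2, h.adj_of_neg m' hm' x hx (by omega) h2, he]
    · rcases le_or_gt 0 (f m) with h3 | h3
      · rw [G.adj_comm m, G.adj_comm m', h.adj_of_pos x hx m hm h3 h1,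
          h.adj_of_pos x hx m' hm' (by omega) (by omega)]
      · rw [h.adj_across m hm x hx h3 h2, h.adj_across m' hm' x hx (by omega) h2]

open Classical in
/-- The colouring of `G` in which the pair of `a` and `v` has been turned red. -/
noncomputable def redPair (G : SimpleGraph V) (a v : V) : V → V → Option Prop :=
  fun x y => if (x = a ∧ y = v) ∨ (x = v ∧ y = a) then none else G.colour x y

theorem ncard_redNbrs_redPair [Finite V] (G : SimpleGraph V) (S : Set V) (a v x : V) :
    (redNbrs (G.redPair a v) S x).ncard ≤ 1 := by
  classical
  refine (Set.ncard_le_ncard (t := {if x = a then v else a}) ?_ (Set.toFinite _)).trans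
    (Set.ncard_singleton _).le
  rintro y ⟨-, hyx, h⟩
  unfold redPair at h
  split_ifs at h with h'
  · rcases h' with ⟨rfl, rfl⟩ | ⟨rfl, rfl⟩
    · simp
    · simp [hyx.symm]
  · simp [colour] at h

/-- If `u` and `b ∈ {a, v}` agree on all other vertices except possibly the other end of the red
pair, then contracting `u` into `b` creates no further red edge. -/
theorem collapses_redPair_of_merge [Finite V] {S : Set V} {a v b u : V} (hbS : b ∈ S)
    (huS : u ∈ S) (hub : b ≠ u) (hb : b = a ∨ b = v)
    (h : Collapses 1 (S \ {u}) (G.redPair a v))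
    (hagree : ∀ y ∈ S, y ≠ u → y ≠ a → y ≠ v → (G.Adj b y ↔ G.Adj u y))
    (hua : u ≠ a) (huv : u ≠ v) : Collapses 1 S (G.redPair a v) := by
  refine .merge S _ b u hbS huS hub (fun x _ => ncard_redNbrs_redPair G S a v x)
    (h.mono fun x hx y hy hxy => ?_)
  by_cases hred : (x = a ∧ y = v) ∨ (x = v ∧ y = a)
  · left; simp [redPair, hred]
  right
  have key : ∀ y ∈ S, y ≠ u → y ≠ b → ¬ ((b = a ∧ y = v) ∨ (b = v ∧ y = a)) →
      G.redPair a v u y = G.redPair a v b y ∧ G.redPair a v y u = G.redPair a v y b := by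
    intro y hy hyu hyb hred
    have hya : y ≠ a := by rintro rfl; rcases hb with rfl | rfl <;> simp_all
    have hyv : y ≠ v := by rintro rfl; rcases hb with rfl | rfl <;> simp_all
    have := hagree y hy hyu hya hyv
    simp [redPair, colour, hya, hyv, this, G.adj_comm y]
  by_cases hxb : x = b
  · subst hxb
    rw [merge_left, (key y hy.1 hy.2 hxy.symm hred).1, mix_self]
  · by_cases hyb : y = b
    · subst hyb
      rw [merge_right _ _ hxb, (key x hx.1 hx.2 hxb (by tauto)).2, mix_self]
    · rw [merge_of_ne _ _ hxb hyb]

/-- With injective levels, all positive vertices can be contracted into the lowest of them, `a`,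
and then all negative vertices into the vertex `v` of level zero; the only red edge throughout
is that between `a` and `v`. -/
theorem IsPolarLabeling.collapses_redPair [Finite V] (h : G.IsPolarLabeling Y f l k)
    (hinj : Set.InjOn f Y) {a v : V} (hv : v ∈ Y) (hv0 : f v = 0) (ha : a ∈ Y) (ha0 : 0 < f a)
    (hmin : ∀ x ∈ Y, 0 < f x → f a ≤ f x) : Collapses 1 Y (G.redPair a v) := by
  induction hn : Y.ncard using Nat.strong_induction_on generalizing Y with
  | _ n ih =>
  have hav : a ≠ v := by rintro rfl; omega
  have step : ∀ u ∈ Y, u ≠ a → u ≠ v → Collapses 1 (Y \ {u}) (G.redPair a v) := by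
    intro u hu hua huv
    have hsub : Y \ {u} ⊆ Y := Set.sdiff_subset
    refine ih (Y \ {u}).ncard ?_ ?_ (hinj.mono hsub) ⟨hv, huv.symm⟩ ⟨ha, hua.symm⟩
      (fun x hx => hmin x hx.1) rfl
    · rw [← hn]
      exact Set.ncard_sdiff_singleton_lt_of_mem hu (Set.toFinite _)
    · exact ⟨⟨v, ⟨hv, huv.symm⟩, hv0⟩, ⟨a, ⟨ha, hua.symm⟩, ha0.ne'⟩,
        fun x hx y hy => h.adj_of_pos x hx.1 y hy.1,
        fun x hx y hy => h.adj_of_neg x hx.1 y hy.1,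
        fun x hx y hy => h.adj_across x hx.1 y hy.1⟩
  by_cases hpos : ∃ u ∈ Y, u ≠ a ∧ 0 < f u
  · obtain ⟨u, ⟨hu, hua, hu0⟩, humin⟩ := Set.exists_min_image {u | u ∈ Y ∧ u ≠ a ∧ 0 < f u} f
      (Set.toFinite _) hpos
    have huv : u ≠ v := by rintro rfl; omega
    refine collapses_redPair_of_merge ha hu hua.symm (Or.inl rfl) (step u hu hua huv) ?_ hua huv
    intro y hy hyu hya hyv
    have hy0 : f y ≠ 0 := fun h0 => hyv (hinj hy hv (h0.trans hv0.symm))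
    rcases lt_or_gt_of_ne hy0 with h0 | h0
    · rw [G.adj_comm a, G.adj_comm u, h.adj_across y hy a ha h0 ha0,
        h.adj_across y hy u hu h0 hu0]
    · have h1 : f u < f y := lt_of_le_of_ne (humin y ⟨hy, hya, h0⟩)
        fun he => hyu (hinj hy hu he.symm)
      have h2 := hmin u hu hu0
      rw [G.adj_comm a, G.adj_comm u, h.adj_of_pos y hy a ha ha0.le (by omega),
        h.adj_of_pos y hy u hu hu0.le h1]
  · by_cases hneg : ∃ u ∈ Y, f u < 0
    · obtain ⟨u, ⟨hu, hu0⟩, humax⟩ := Set.exists_max_image {u | u ∈ Y ∧ f u < 0} f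
        (Set.toFinite _) hneg
      have huv : u ≠ v := by rintro rfl; omega
      have hua : u ≠ a := by rintro rfl; omega
      refine collapses_redPair_of_merge hv hu huv.symm (Or.inr rfl) (step u hu hua huv) ?_
        hua huv
      intro y hy hyu hya hyv
      have hy0 : f y ≠ 0 := fun h0 => hyv (hinj hy hv (h0.trans hv0.symm))
      have h0 : f y < 0 := by
        refine lt_of_le_of_ne (not_lt.1 fun h0 => hpos ⟨y, hy, hya, h0⟩) hy0
      have h1 : f y < f u := lt_of_le_of_ne (humax y ⟨hy, h0⟩) fun he => hyu (hinj hy hu he)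
      rw [G.adj_comm v, G.adj_comm u, h.adj_of_neg y hy v hv (by omega) hv0.le,
        h.adj_of_neg y hy u hu h1 hu0.le]
    · refine .merge Y _ a v ha hv hav (fun x _ => ncard_redNbrs_redPair G Y a v x) ?_
      have : Y \ {v} = {a} := by
        ext x
        simp only [Set.mem_sdiff, Set.mem_singleton_iff]
        constructor
        · rintro ⟨hx, hxv⟩
          by_contra hxa
          rcases lt_trichotomy (f x) 0 with h0 | h0 | h0
          · exact hneg ⟨x, hx, h0⟩
          · exact hxv (hinj hx hv (h0.trans hv0.symm))
          · exact hpos ⟨x, hx, hxa, h0⟩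
        · rintro rfl; exact ⟨ha, hav⟩
      rw [this]
      exact .single a _

/-- A graph in which every set of at least two vertices has a polar labeling is
`1`-collapsible: levels with several vertices are modules and can be collapsed separately, which
leaves the case of injective levels. -/
theorem collapses_of_hasPolarLabeling [Finite V] (hY : Y.Nonempty)
    (h : ∀ Z ⊆ Y, Z.Nontrivial → G.HasPolarLabeling Z) : Collapses 1 Y G.colour := by
  induction hn : Y.ncard using Nat.strong_induction_on generalizing Y with
  | _ n ih =>
  rcases Set.subsingleton_or_nontrivial Y with hs | hs
  · obtain ⟨x, hx⟩ := hY
    rw [hs.eq_singleton_of_mem hx]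
    exact .single x _
  obtain ⟨f, l, k, hf⟩ := h Y Set.Subset.rfl hs
  by_cases hinj : Set.InjOn f Y
  · -- reversing all signs if necessary, there is a positive level
    have main : ∀ (f : V → ℤ) (l : ℤ → Prop), G.IsPolarLabeling Y f l k → Set.InjOn f Y →
        (∃ a ∈ Y, 0 < f a) → Collapses 1 Y G.colour := by
      intro f l hf hinj hpos
      obtain ⟨a, ⟨ha, ha0⟩, hmin⟩ := Set.exists_min_image {a | a ∈ Y ∧ 0 < f a} f
        (Set.toFinite _) hpos
      obtain ⟨v, hv, hv0⟩ := hf.exists_zero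
      refine (hf.collapses_redPair hinj hv hv0 ha ha0 fun x hx hx0 => hmin x ⟨hx, hx0⟩).mono
        fun x _ y _ _ => ?_
      by_cases hred : (x = a ∧ y = v) ∨ (x = v ∧ y = a)
      · left; simp [redPair, hred]
      · right; simp [redPair, hred]
    obtain ⟨a, ha, ha0⟩ := hf.exists_ne_zero
    rcases lt_or_gt_of_ne ha0 with h0 | h0
    · exact main _ _ hf.neg (fun x hx y hy he => hinj hx hy (neg_injective he))
        ⟨a, ha, by omega⟩
    · exact main f l hf hinj ⟨a, ha, h0⟩
  · obtain ⟨x, hx, y, hy, hxy, hne⟩ : ∃ x ∈ Y, ∃ y ∈ Y, f x = f y ∧ x ≠ y := by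
      simpa [Set.InjOn] using hinj
    set M : Set V := {z | z ∈ Y ∧ f z = f x} with hM
    have hMY : M ⊆ Y := fun z hz => hz.1
    have hxM : x ∈ M := ⟨hx, rfl⟩
    have hyM : y ∈ M := ⟨hy, hxy.symm⟩
    refine collapses_of_module (ih M.ncard ?_ ⟨x, hxM⟩ (fun Z hZ => h Z (hZ.trans hMY)) rfl)
      hMY ?_ ?_
    · rw [← hn]
      refine Set.ncard_lt_ncard (hMY.ssubset_of_ne fun he => ?_) (Set.toFinite _)
      obtain ⟨v, hv, hv0⟩ := hf.exists_zero
      obtain ⟨a, ha, ha0⟩ := hf.exists_ne_zero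
      rw [← he] at hv ha
      exact ha0 (ha.2.trans (hv.2.symm.trans hv0))
    · rintro z ⟨hz, hzM⟩ m hm m' hm' hadj
      exact (hf.adj_iff_of_eq hm.1 hm'.1 hz (hm.2.trans hm'.2.symm)
        fun he => hzM ⟨hz, he.trans hm.2⟩).1 hadj
    · intro r hr
      have hsub : insert r (Y \ M) ⊆ Y := Set.insert_subset hr.1 Set.sdiff_subset
      refine ih _ ?_ (Set.insert_nonempty _ _) (fun Z hZ => h Z (hZ.trans hsub)) rfl
      rw [← hn]
      refine Set.ncard_lt_ncard (hsub.ssubset_of_ne fun he => ?_) (Set.toFinite _)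
      have h1 : ∀ z ∈ M, z = r := by
        intro z hz
        have hz' := hMY hz
        rw [← he] at hz'
        exact hz'.resolve_right fun hz' => hz'.2 hz
      exact hne ((h1 x hxM).trans (h1 y hyM).symm)

/-! ### Pseudo-cographs -/

/-- The rank of a vertex `x` of a cograph with respect to the vertex `v` tells how far away from
`v` the branch with `x` leaves the path from `v` to the root of the cotree. -/
theorem IsCographOn.exists_rank [Finite V] {A : Set V} (h : G.IsCographOn A) {v : V}
    (hv : v ∈ A) : ∃ (f : V → ℕ) (l : ℕ → Prop), f v = 0 ∧ (∀ x ∈ A, x ≠ v → 0 < f x) ∧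
      ∀ x ∈ A, ∀ y ∈ A, f y < f x → (G.Adj x y ↔ l (f x)) := by
  classical
  have step : ∀ (A B : Set V) (k : Prop), Disjoint A B → v ∈ A →
      (∀ a ∈ A, ∀ b ∈ B, (G.Adj a b ↔ k)) →
      (∃ (f : V → ℕ) (l : ℕ → Prop), f v = 0 ∧ (∀ x ∈ A, x ≠ v → 0 < f x) ∧
        ∀ x ∈ A, ∀ y ∈ A, f y < f x → (G.Adj x y ↔ l (f x))) →
      ∃ (f : V → ℕ) (l : ℕ → Prop), f v = 0 ∧ (∀ x ∈ A ∪ B, x ≠ v → 0 < f x) ∧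
        ∀ x ∈ A ∪ B, ∀ y ∈ A ∪ B, f y < f x → (G.Adj x y ↔ l (f x)) := by
    rintro A B k hAB hv hk ⟨f, l, h0, hpos, hl⟩
    obtain ⟨m, -, hm⟩ := Set.exists_max_image Set.univ f (Set.toFinite _) ⟨v, trivial⟩
    have e1 : ∀ x, x ∈ A → (if x ∈ A then f x else f m + 1) = f x := fun x hx => if_pos hx
    have e2 : ∀ x, x ∉ A → (if x ∈ A then f x else f m + 1) = f m + 1 := fun x hx => if_neg hx
    -- the vertices of `B` branch off outside of all of `A`, at a new highest rank
    refine ⟨fun x => if x ∈ A then f x else f m + 1, fun i => if i = f m + 1 then k else l i,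
      by simp [hv, h0], ?_, ?_⟩
    · intro x hx hxv
      by_cases hxA : x ∈ A
      · simpa [hxA] using hpos x hxA hxv
      · simp [hxA]
    · intro x hx y hy hlt
      by_cases hxA : x ∈ A
      · have hx' := hm x trivial
        have hyA : y ∈ A := by
          by_contra hyA
          simp only [hxA, hyA, if_true, if_false] at hlt
          omega
        simp only [hxA, hyA, if_true] at hlt ⊢
        rw [if_neg (by omega)]
        exact hl x hxA y hyA hlt
      · have hyA : y ∈ A := by
          by_contra hyA
          simp only [hxA, hyA, if_false] at hlt
          omega
        simp only [hxA, if_false, if_true]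
        rw [G.adj_comm]
        exact hk y hyA x (hx.resolve_left hxA)
  induction h with
  | single x =>
    obtain rfl : v = x := hv
    refine ⟨fun _ => 0, fun _ => True, rfl, fun x hx hne => absurd hx hne, ?_⟩
    intro x _ y _ h
    exact absurd h (lt_irrefl _)
  | disjointUnion A B _ _ hAB h ihA ihB =>
    rcases hv with hv | hv
    · exact step A B False hAB hv (by simpa using h) (ihA hv)
    · rw [Set.union_comm]
      exact step B A False hAB.symm hv
        (fun b hb a ha => by rw [G.adj_comm]; simpa using h a ha b hb) (ihB hv)
  | join A B _ _ hAB h ihA ihB =>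
    rcases hv with hv | hv
    · exact step A B True hAB hv (by simpa using h) (ihA hv)
    · rw [Set.union_comm]
      exact step B A True hAB.symm hv
        (fun b hb a ha => by rw [G.adj_comm]; simpa using h a ha b hb) (ihB hv)

theorem IsPseudoCographWith.hasPolarLabeling [Finite V] {v : V} {A B : Set V}
    (h : G.IsPseudoCographWith v A B) (hY : Y.Nontrivial) : G.HasPolarLabeling Y := by
  classical
  obtain ⟨k, hk⟩ : ∃ k : Prop, ∀ a ∈ A \ {v}, ∀ b ∈ B \ {v}, (G.Adj a b ↔ k) := by
    rcases h.join_or_union with h | h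
    · exact ⟨True, by simpa using h⟩
    · exact ⟨False, by simpa using h⟩
  have hmem : ∀ x, x ∈ A ∨ x ∈ B := fun x => by
    have : x ∈ A ∪ B := h.union_eq ▸ Set.mem_univ x
    exact this
  have hAB : ∀ x, x ∈ A → x ∈ B → x = v := fun x hA hB => by
    have : x ∈ A ∩ B := ⟨hA, hB⟩
    rwa [h.inter_eq] at this
  obtain ⟨hvA, hvB⟩ : v ∈ A ∩ B := h.inter_eq ▸ Set.mem_singleton v
  by_cases hv : v ∈ Y
  · obtain ⟨f, l, f0, fpos, hf⟩ := h.cograph_left.exists_rank hvA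
    obtain ⟨g, l', g0, gpos, hg⟩ := h.cograph_right.exists_rank hvB
    let F : V → ℤ := fun x => if x ∈ A then (f x : ℤ) else - (g x : ℤ)
    have FA : ∀ x, x ∈ A → F x = f x := fun x hx => if_pos hx
    have FB : ∀ x, x ∈ B → F x = - (g x : ℤ) := by
      intro x hx
      by_cases hxA : x ∈ A
      · obtain rfl := hAB x hxA hx
        rw [FA x hxA, f0, g0]; rfl
      · exact if_neg hxA
    have Fpos : ∀ x, 0 < F x → x ∈ A ∧ x ≠ v := by
      intro x hx
      refine ⟨(hmem x).resolve_right fun hxB => ?_, ?_⟩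
      · rw [FB x hxB] at hx; omega
      · rintro rfl; rw [FA x hvA, f0] at hx; simp at hx
    have Fneg : ∀ x, F x < 0 → x ∈ B ∧ x ≠ v := by
      intro x hx
      refine ⟨(hmem x).resolve_left fun hxA => ?_, ?_⟩
      · rw [FA x hxA] at hx; omega
      · rintro rfl; rw [FA x hvA, f0] at hx; simp at hx
    have F0 : ∀ x, F x = 0 → x = v := by
      intro x hx
      by_contra hne
      rcases hmem x with hxA | hxB
      · have := fpos x hxA hne
        rw [FA x hxA] at hx; omega
      · have := gpos x hxB hne
        rw [FB x hxB] at hx; omega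
    refine ⟨F, fun i => if 0 < i then l i.toNat else l' (-i).toNat, k, ⟨v, hv, ?_⟩, ?_, ?_, ?_, ?_⟩
    · rw [FA v hvA, f0]; rfl
    · obtain ⟨a, ha, hav⟩ := hY.exists_ne v
      exact ⟨a, ha, fun h0 => hav (F0 a h0)⟩
    · intro x _ y _ hy0 hlt
      obtain ⟨hxA, -⟩ := Fpos x (by omega)
      have hyA : y ∈ A := by
        rcases hy0.eq_or_lt with h0 | h0
        · rw [F0 y h0.symm]; exact hvA
        · exact (Fpos y h0).1
      simp only [show 0 < F x by omega, if_true]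
      rw [FA x hxA, FA y hyA] at *
      rw [hf x hxA y hyA (by omega), Int.toNat_natCast]
    · intro x _ y _ hlt hy0
      obtain ⟨hxB, -⟩ := Fneg x (by omega)
      have hyB : y ∈ B := by
        rcases hy0.eq_or_lt with h0 | h0
        · rw [F0 y h0]; exact hvB
        · exact (Fneg y h0).1
      simp only [show ¬ 0 < F x by omega, if_false]
      rw [FB x hxB, FB y hyB] at *
      rw [hg x hxB y hyB (by omega), neg_neg, Int.toNat_natCast]
    · intro x _ y _ hx hy
      rw [G.adj_comm]
      exact hk y (Fpos y hy) x (Fneg x hx)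
  · have hne : ∀ x ∈ Y, x ≠ v := fun x hx hxv => hv (hxv ▸ hx)
    by_cases h1 : Y ⊆ A
    · obtain ⟨Z, k, h1, h2, h3⟩ := h.cograph_left.exists_split h1 hY
      exact .of_split h1 h2 h3
    by_cases h2 : Y ⊆ B
    · obtain ⟨Z, k, h1, h2, h3⟩ := h.cograph_right.exists_split h2 hY
      exact .of_split h1 h2 h3
    obtain ⟨x, hx, hxA⟩ := Set.not_subset.1 h1
    obtain ⟨y, hy, hyB⟩ := Set.not_subset.1 h2
    exact .of_split (Z := A) ⟨y, hy, (hmem y).resolve_right hyB⟩ ⟨x, hx, hxA⟩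
      fun a ha b hb => hk a ⟨ha.2, hne a ha.1⟩ b ⟨(hmem b).resolve_left hb.2, hne b hb.1⟩

end SimpleGraph

namespace Digraph

variable {W : Type*} {N : Digraph W}

/-! ### Ancestors in acyclic digraphs -/

theorem IsAncestor.exists_child {u v : W} (h : N.IsAncestor u v) (hne : u ≠ v) :
    ∃ c, N.Adj u c ∧ N.IsAncestor c v := by
  rcases Relation.ReflTransGen.cases_head h with h | h
  exacts [absurd h hne, h]

theorem IsAncestor.exists_parent {u v : W} (h : N.IsAncestor u v) (hne : u ≠ v) :
    ∃ p, N.IsAncestor u p ∧ N.Adj p v := by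
  rcases Relation.ReflTransGen.cases_tail h with h | h
  exacts [absurd h.symm hne, h]

theorem IsAncestor.trans {u v w : W} (h : N.IsAncestor u v) (h' : N.IsAncestor v w) :
    N.IsAncestor u w := Relation.ReflTransGen.trans h h'

theorem IsAncestor.refl (u : W) : N.IsAncestor u u := Relation.ReflTransGen.refl

theorem IsAncestor.of_adj {u v : W} (h : N.Adj u v) : N.IsAncestor u v :=
  Relation.ReflTransGen.single h

theorem IsAcyclic.not_isAncestor_of_adj (hN : N.IsAcyclic) {u v : W} (h : N.Adj u v) :
    ¬ N.IsAncestor v u :=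
  fun h' => hN u (Relation.TransGen.head' h h')

theorem IsAcyclic.ne_of_adj (hN : N.IsAcyclic) {u v : W} (h : N.Adj u v) : u ≠ v := by
  rintro rfl
  exact hN.not_isAncestor_of_adj h (.refl _)

theorem IsAcyclic.antisymm (hN : N.IsAcyclic) {u v : W} (h : N.IsAncestor u v)
    (h' : N.IsAncestor v u) : u = v := by
  by_contra hne
  obtain ⟨c, hc, hcv⟩ := h.exists_child hne
  exact hN.not_isAncestor_of_adj hc (hcv.trans h')

theorem IsAcyclic.exists_lowest [Finite W] (hN : N.IsAcyclic) {P : W → Prop} (hP : ∃ x, P x) :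
    ∃ m, P m ∧ ∀ x, P x → N.IsAncestor m x → x = m := by
  let r : W → W → Prop := fun a b => Relation.TransGen N.Adj b a
  have : IsTrans W r := ⟨fun a b c h h' => Relation.TransGen.trans h' h⟩
  have : Std.Irrefl r := ⟨fun a h => hN a h⟩
  have wf : WellFounded r := Finite.wellFounded_of_trans_of_irrefl r
  obtain ⟨m, hm, hmin⟩ := wf.has_min {x | P x} hP
  refine ⟨m, hm, fun x hx hmx => ?_⟩
  rcases Relation.reflTransGen_iff_eq_or_transGen.1 hmx with h | h
  exacts [h, absurd h (hmin x hx)]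

theorem IsAcyclic.exists_highest [Finite W] (hN : N.IsAcyclic) {P : W → Prop} (hP : ∃ x, P x) :
    ∃ m, P m ∧ ∀ x, P x → N.IsAncestor x m → x = m := by
  let r : W → W → Prop := fun a b => Relation.TransGen N.Adj a b
  have : IsTrans W r := ⟨fun a b c h h' => Relation.TransGen.trans h h'⟩
  have : Std.Irrefl r := ⟨fun a h => hN a h⟩
  have wf : WellFounded r := Finite.wellFounded_of_trans_of_irrefl r
  obtain ⟨m, hm, hmin⟩ := wf.has_min {x | P x} hP
  refine ⟨m, hm, fun x hx hmx => ?_⟩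
  rcases Relation.reflTransGen_iff_eq_or_transGen.1 hmx with h | h
  exacts [h.symm, absurd h (hmin x hx)]

/-! ### Degrees in galled-trees -/

theorem two_le_inDeg [Finite W] {u u' v : W} (h : N.Adj u v) (h' : N.Adj u' v) (hne : u ≠ u') :
    2 ≤ N.inDeg v :=
  (Set.one_lt_ncard (Set.toFinite _)).2 ⟨u, h, u', h', hne⟩

theorem IsHybrid.eq_or_eq [Finite W] {v u u' x : W} (hv : N.IsHybrid v) (hu : N.Adj u v)
    (hu' : N.Adj u' v) (hne : u ≠ u') (hx : N.Adj x v) : x = u ∨ x = u' := by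
  have h1 : ({u, u'} : Set W) = {y | N.Adj y v} := by
    refine Set.eq_of_subset_of_ncard_le ?_ ?_ (Set.toFinite _)
    · rintro y (rfl | rfl)
      exacts [hu, hu']
    · rw [Set.ncard_pair hne]
      exact hv.1.le
  have h2 : x ∈ ({u, u'} : Set W) := h1 ▸ hx
  exact h2

namespace IsGalledTree

variable {X : Set W}

theorem acyclic (hN : N.IsGalledTree X) : N.IsAcyclic := hN.1

theorem not_adj_of_leaf [Finite W] (hN : N.IsGalledTree X) {x u : W} (hx : x ∈ X) : ¬ N.Adj x u := by
  intro hu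
  rcases hN.2 with ⟨y, hy, huniv⟩ | ⟨-, hX, -⟩
  · have h1 : x ∈ ({y} : Set W) := hy ▸ hx
    have h2 : u ∈ ({y} : Set W) := by rw [← hy, huniv]; trivial
    exact hN.acyclic.ne_of_adj hu (h1.trans h2.symm)
  · have := ((hX x).1 hx).1
    rw [outDeg, Set.ncard_eq_zero (Set.toFinite _)] at this
    exact Set.notMem_empty u (this ▸ hu)

theorem isHybrid_of_adj [Finite W] (hN : N.IsGalledTree X) {u u' v : W}
    (h : N.Adj u v) (h' : N.Adj u' v) (hne : u ≠ u') : N.IsHybrid v := by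
  have h2 := two_le_inDeg h h' hne
  rcases hN.2 with ⟨y, hy, huniv⟩ | ⟨⟨r, hr, -, hv⟩, hX, -⟩
  · have key : ∀ z, z = y := fun z => by
      have : z ∈ ({y} : Set W) := by rw [← hy, huniv]; trivial
      exact this
    exact absurd ((key u).trans (key u').symm) hne
  · have hvX : v ∉ X := fun hvX => by
      have := ((hX v).1 hvX).2
      omega
    have hvr : v ≠ r := fun hvr => by
      rw [hvr] at h2
      omega
    rcases hv v hvX hvr with h3 | h3
    · have := h3.1
      omega
    · exact h3

/-- The root is an ancestor of every vertex, as it is the only vertex without parents. -/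
theorem exists_common_ancestor [Finite W] (hN : N.IsGalledTree X) (x y : W) :
    ∃ r, N.IsAncestor r x ∧ N.IsAncestor r y := by
  rcases hN.2 with ⟨z, hz, huniv⟩ | ⟨⟨r, hr, -, hv⟩, hX, -⟩
  · have key : ∀ w, w = z := fun w => by
      have : w ∈ ({z} : Set W) := by rw [← hz, huniv]; trivial
      exact this
    exact ⟨x, .refl x, by rw [key x, key y]; exact .refl z⟩
  · have key : ∀ x, N.IsAncestor r x := by
      intro x
      obtain ⟨m, hm, hmax⟩ := hN.acyclic.exists_highest (P := fun z => N.IsAncestor z x)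
        ⟨x, .refl x⟩
      have hnp : ∀ p, ¬ N.Adj p m := fun p hp =>
        hN.acyclic.ne_of_adj hp (hmax p ((IsAncestor.of_adj hp).trans hm) (.of_adj hp))
      have h0 : N.inDeg m = 0 := by
        rw [inDeg, Set.ncard_eq_zero (Set.toFinite _)]
        exact Set.eq_empty_of_forall_notMem hnp
      have hmr : m = r := by
        by_contra hmr
        have hmX : m ∉ X := fun hmX => by
          have := ((hX m).1 hmX).2
          omega
        rcases hv m hmX hmr with h | h
        · have := h.1
          omega
        · have := h.1
          omega
      exact hmr ▸ hm
    exact ⟨r, key x, key y⟩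

end IsGalledTree

/-! ### Biconnected vertex sets -/

/-- Any two vertices of `S` are joined by a path inside `S` that ignores orientations. -/
def ConnectedOn (N : Digraph W) (S : Set W) : Prop :=
  ∀ x ∈ S, ∀ y ∈ S,
    Relation.ReflTransGen (fun a b => a ∈ S ∧ b ∈ S ∧ (N.Adj a b ∨ N.Adj b a)) x y

/-- `S` is connected and remains so when any one vertex is removed. -/
def BiconnectedOn (N : Digraph W) (S : Set W) : Prop :=
  N.ConnectedOn S ∧ ∀ v, N.ConnectedOn (S \ {v})

theorem connectedOn_of_hub {S : Set W} (z : W)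
    (h : ∀ x ∈ S, Relation.ReflTransGen
      (fun a b => a ∈ S ∧ b ∈ S ∧ (N.Adj a b ∨ N.Adj b a)) x z) : N.ConnectedOn S := by
  have hs : Std.Symm (fun a b => a ∈ S ∧ b ∈ S ∧ (N.Adj a b ∨ N.Adj b a)) :=
    ⟨fun a b h => ⟨h.2.1, h.1, h.2.2.symm⟩⟩
  intro x hx y hy
  exact (h x hx).trans (symm (h y hy))

theorem ConnectedOn.union {S T : Set W} (hS : N.ConnectedOn S) (hT : N.ConnectedOn T)
    (h : (S ∩ T).Nonempty) : N.ConnectedOn (S ∪ T) := by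
  obtain ⟨z, hzS, hzT⟩ := h
  refine connectedOn_of_hub z fun x hx => ?_
  rcases hx with hx | hx
  · exact Relation.ReflTransGen.mono (fun a b h => ⟨Or.inl h.1, Or.inl h.2.1, h.2.2⟩) _ _
      (hS x hx z hzS)
  · exact Relation.ReflTransGen.mono (fun a b h => ⟨Or.inr h.1, Or.inr h.2.1, h.2.2⟩) _ _
      (hT x hx z hzT)

theorem BiconnectedOn.union {S T : Set W} (hS : N.BiconnectedOn S) (hT : N.BiconnectedOn T)
    (h : (S ∩ T).Nontrivial) : N.BiconnectedOn (S ∪ T) := by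
  refine ⟨hS.1.union hT.1 h.nonempty, fun v => ?_⟩
  rw [Set.union_sdiff_distrib]
  obtain ⟨x, hx, hxv⟩ := h.exists_ne v
  exact (hS.2 v).union (hT.2 v) ⟨x, ⟨hx.1, hxv⟩, hx.2, hxv⟩

theorem ConnectedOn.preconnected_induce (hN : N.IsAcyclic) {S : Set W} (h : N.ConnectedOn S) :
    ((⊤ : N.toSimpleGraphInclusive.Subgraph).induce S).Preconnected := by
  refine ⟨fun x y => ?_⟩
  have key : ∀ a b : W, Relation.ReflTransGen
      (fun a b => a ∈ S ∧ b ∈ S ∧ (N.Adj a b ∨ N.Adj b a)) a b → ∀ (ha : a ∈ S) (hb : b ∈ S),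
      ((⊤ : N.toSimpleGraphInclusive.Subgraph).induce S).coe.Reachable ⟨a, ha⟩ ⟨b, hb⟩ := by
    intro a b hab
    induction hab with
    | refl => intro _ _; exact SimpleGraph.Reachable.refl _
    | @tail b d _ hbd ih =>
      intro ha hd
      refine (ih ha hbd.1).trans (SimpleGraph.Adj.reachable ?_)
      have hne : b ≠ d := by
        rcases hbd.2.2 with h | h
        exacts [hN.ne_of_adj h, (hN.ne_of_adj h).symm]
      exact ⟨hbd.1, hd, hne, hbd.2.2⟩
  exact key _ _ (h _ x.2 _ y.2) x.2 y.2

theorem BiconnectedOn.isBiconnected (hN : N.IsAcyclic) {S : Set W} (h : N.BiconnectedOn S)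
    (hne : S.Nonempty) :
    ((⊤ : N.toSimpleGraphInclusive.Subgraph).induce S).IsBiconnected := by
  refine ⟨SimpleGraph.Subgraph.connected_iff.2
    ⟨h.1.preconnected_induce hN, hne⟩, fun v _ => ?_⟩
  have : ((⊤ : N.toSimpleGraphInclusive.Subgraph).induce S).deleteVerts {v} =
      (⊤ : N.toSimpleGraphInclusive.Subgraph).induce (S \ {v}) := by
    ext a b
    · simp
    · simp only [SimpleGraph.Subgraph.induce_adj,
        SimpleGraph.Subgraph.induce_verts, SimpleGraph.Subgraph.top_adj, Set.mem_sdiff]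
      tauto
  rw [this]
  exact (h.2 v).preconnected_induce hN

/-- A biconnected vertex set contains at most one hybrid-vertex together with its parents. -/
theorem IsGalledTree.eq_of_biconnectedOn [Finite W] {X S : Set W} (hN : N.IsGalledTree X)
    (hS : N.BiconnectedOn S) {h k : W} (hh : N.IsHybrid h) (hk : N.IsHybrid k) (hhS : h ∈ S)
    (hkS : k ∈ S) (hhp : ∀ u, N.Adj u h → u ∈ S) (hkp : ∀ u, N.Adj u k → u ∈ S) : h = k := by
  obtain ⟨C, hC, hmax⟩ := Finite.exists_le_maximal (hS.isBiconnected hN.acyclic ⟨h, hhS⟩)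
  have hSC : S ⊆ C.verts := hC.1
  rcases hN.2 with ⟨y, hy, huniv⟩ | ⟨-, -, hblock⟩
  · have key : ∀ z, z = y := fun z => by
      have : z ∈ ({y} : Set W) := by rw [← hy, huniv]; trivial
      exact this
    rw [key h, key k]
  · exact hblock C hmax ⟨hSC hhS, hh, fun u hu => hSC (hhp u hu)⟩
      ⟨hSC hkS, hk, fun u hu => hSC (hkp u hu)⟩

/-- If `u` is an ancestor of `v` and everything between them lies in `S`, then `u` and `v` are
connected in `S`. -/
theorem IsAncestor.connected {S : Set W} {u v : W} (h : N.IsAncestor u v)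
    (hS : ∀ z, N.IsAncestor u z → N.IsAncestor z v → z ∈ S) :
    Relation.ReflTransGen (fun a b => a ∈ S ∧ b ∈ S ∧ (N.Adj a b ∨ N.Adj b a)) u v := by
  induction h with
  | refl => exact .refl
  | @tail b d hb hbd ih =>
    exact (ih fun z hz hz' => hS z hz (hz'.trans (.of_adj hbd))).tail
      ⟨hS b hb (.of_adj hbd), hS d (hb.tail hbd) (.refl d), Or.inl hbd⟩

theorem IsAncestor.connected_symm {S : Set W} {u v : W} (h : N.IsAncestor u v)
    (hS : ∀ z, N.IsAncestor u z → N.IsAncestor z v → z ∈ S) :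
    Relation.ReflTransGen (fun a b => a ∈ S ∧ b ∈ S ∧ (N.Adj a b ∨ N.Adj b a)) v u := by
  have hs : Std.Symm (fun a b => a ∈ S ∧ b ∈ S ∧ (N.Adj a b ∨ N.Adj b a)) :=
    ⟨fun a b h => ⟨h.2.1, h.1, h.2.2.symm⟩⟩
  exact symm (h.connected hS)

/-! ### Galls -/

/-- A gall with source `s` and sink `h`: two children `c ≠ c'` of `s` with a common descendant
`h` that is highest among the common descendants. -/
structure IsGall (N : Digraph W) (s c c' h : W) : Prop where
  adj_left : N.Adj s c
  adj_right : N.Adj s c'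
  ne : c ≠ c'
  left : N.IsAncestor c h
  right : N.IsAncestor c' h
  highest : ∀ x, N.IsAncestor c x → N.IsAncestor c' x → N.IsAncestor x h → x = h

/-- The vertices of a gall: its source, and everything between a child and the sink. In a
galled-tree these are the vertices of an undirected cycle, but no path has to be chosen to
define them. -/
def gallVerts (N : Digraph W) (s c c' h : W) : Set W :=
  {x | x = s ∨ (N.IsAncestor c x ∨ N.IsAncestor c' x) ∧ N.IsAncestor x h}

theorem mem_gallVerts {s c c' h x : W} : x ∈ N.gallVerts s c c' h ↔
    x = s ∨ (N.IsAncestor c x ∨ N.IsAncestor c' x) ∧ N.IsAncestor x h := Iff.rfl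

theorem gallVerts_swap (s c c' h : W) : N.gallVerts s c' c h = N.gallVerts s c c' h := by
  ext x
  rw [mem_gallVerts, mem_gallVerts, or_comm (a := N.IsAncestor c' x)]

namespace IsGall

variable {s c c' h : W}

theorem symm (hg : N.IsGall s c c' h) : N.IsGall s c' c h :=
  ⟨hg.adj_right, hg.adj_left, hg.ne.symm, hg.right, hg.left, fun x h1 h2 => hg.highest x h2 h1⟩

theorem source_mem (_ : N.IsGall s c c' h) : s ∈ N.gallVerts s c c' h := Or.inl rfl

theorem left_mem (hg : N.IsGall s c c' h) : c ∈ N.gallVerts s c c' h :=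
  Or.inr ⟨Or.inl (.refl c), hg.left⟩

theorem right_mem (hg : N.IsGall s c c' h) : c' ∈ N.gallVerts s c c' h :=
  Or.inr ⟨Or.inr (.refl c'), hg.right⟩

theorem sink_mem (hg : N.IsGall s c c' h) : h ∈ N.gallVerts s c c' h :=
  Or.inr ⟨Or.inl hg.left, .refl h⟩

/-- On each of its two sides, the sink of a gall has a parent. -/
theorem exists_parent_left (hg : N.IsGall s c c' h) :
    ∃ p, N.Adj p h ∧ (p = s ∧ c = h ∨ N.IsAncestor c p) := by
  by_cases hch : c = h
  · exact ⟨s, hch ▸ hg.adj_left, Or.inl ⟨rfl, hch⟩⟩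
  · obtain ⟨p, hp, hph⟩ := hg.left.exists_parent hch
    exact ⟨p, hph, Or.inr hp⟩

theorem parents [Finite W] {X : Set W} (hN : N.IsGalledTree X) (hg : N.IsGall s c c' h) :
    N.IsHybrid h ∧ ∀ u, N.Adj u h → u ∈ N.gallVerts s c c' h := by
  obtain ⟨p, hp, hp'⟩ := hg.exists_parent_left
  obtain ⟨q, hq, hq'⟩ := hg.symm.exists_parent_left
  have hpq : p ≠ q := by
    rintro rfl
    rcases hp' with ⟨rfl, h1⟩ | h1 <;> rcases hq' with ⟨h3, h2⟩ | h2
    · exact hg.ne (h1.trans h2.symm)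
    · exact hN.acyclic.not_isAncestor_of_adj hg.adj_right h2
    · exact hN.acyclic.not_isAncestor_of_adj hg.adj_left (h3 ▸ h1)
    · exact hN.acyclic.ne_of_adj hp (hg.highest p h1 h2 (.of_adj hp))
  have hh := hN.isHybrid_of_adj hp hq hpq
  refine ⟨hh, fun u hu => ?_⟩
  rcases hh.eq_or_eq hp hq hpq hu with rfl | rfl
  · exact hp'.imp (·.1) fun h1 => ⟨Or.inl h1, .of_adj hu⟩
  · exact hq'.imp (·.1) fun h1 => ⟨Or.inr h1, .of_adj hu⟩

theorem biconnectedOn (hN : N.IsAcyclic) (hg : N.IsGall s c c' h) :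
    N.BiconnectedOn (N.gallVerts s c c' h) := by
  -- without `v`, a vertex `x` of the side of `d` reaches the sink or, if `v` is in between,
  -- the source
  have hside : ∀ d d', N.IsGall s d d' h → N.gallVerts s d d' h = N.gallVerts s c c' h →
      ∀ v, v ≠ h → v ≠ s → ∀ x, x ≠ v → N.IsAncestor d x → N.IsAncestor x h →
      Relation.ReflTransGen (fun a b => a ∈ N.gallVerts s c c' h \ {v} ∧
        b ∈ N.gallVerts s c c' h \ {v} ∧ (N.Adj a b ∨ N.Adj b a)) x h ∨
      N.IsAncestor x v ∧
      Relation.ReflTransGen (fun a b => a ∈ N.gallVerts s c c' h \ {v} ∧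
        b ∈ N.gallVerts s c c' h \ {v} ∧ (N.Adj a b ∨ N.Adj b a)) x s := by
    intro d d' hd hdd v hvh hvs x hxv hdx hxh
    rw [← hdd]
    by_cases hxv' : N.IsAncestor x v
    · have hzmem : ∀ z, N.IsAncestor d z → N.IsAncestor z x →
          z ∈ N.gallVerts s d d' h \ {v} := by
        intro z hz hz'
        refine ⟨Or.inr ⟨Or.inl hz, hz'.trans hxh⟩, ?_⟩
        rintro rfl
        exact hxv (hN.antisymm hxv' hz')
      refine Or.inr ⟨hxv', (hdx.connected_symm hzmem).tail ⟨hzmem d (.refl d) hdx, ?_,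
        Or.inr hd.adj_left⟩⟩
      exact ⟨Or.inl rfl, Ne.symm hvs⟩
    · refine Or.inl (hxh.connected fun z hz hz' => ⟨Or.inr ⟨Or.inl (hdx.trans hz), hz'⟩, ?_⟩)
      rintro rfl
      exact hxv' hz
  -- the side that does not contain `v` joins the source to the sink
  have hsource : ∀ d d', N.IsGall s d d' h → N.gallVerts s d d' h = N.gallVerts s c c' h →
      ∀ v, v ≠ s → ¬ (N.IsAncestor d v ∧ N.IsAncestor v h) →
      Relation.ReflTransGen (fun a b => a ∈ N.gallVerts s c c' h \ {v} ∧
        b ∈ N.gallVerts s c c' h \ {v} ∧ (N.Adj a b ∨ N.Adj b a)) s h := by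
    intro d d' hd hdd v hvs hv
    rw [← hdd]
    have hzmem : ∀ z, N.IsAncestor d z → N.IsAncestor z h →
        z ∈ N.gallVerts s d d' h \ {v} := by
      intro z hz hz'
      refine ⟨Or.inr ⟨Or.inl hz, hz'⟩, ?_⟩
      rintro rfl
      exact hv ⟨hz, hz'⟩
    exact (hd.left.connected hzmem).head
      ⟨⟨Or.inl rfl, Ne.symm hvs⟩, hzmem d (.refl d) hd.left, Or.inl hd.adj_left⟩
  have hswap := N.gallVerts_swap s c c' h
  have hdel : ∀ v, N.ConnectedOn (N.gallVerts s c c' h \ {v}) := by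
    intro v
    by_cases hvs : v = s
    · subst hvs
      refine connectedOn_of_hub h fun x hx => ?_
      obtain ⟨hx1, hx2⟩ := hx.1.resolve_left hx.2
      refine hx2.connected fun z hz hz' => ⟨Or.inr ⟨hx1.imp (·.trans hz) (·.trans hz), hz'⟩, ?_⟩
      rintro rfl
      rcases hx1 with hx1 | hx1
      · exact hN.not_isAncestor_of_adj hg.adj_left (hx1.trans hz)
      · exact hN.not_isAncestor_of_adj hg.adj_right (hx1.trans hz)
    by_cases hvh : v = h
    · subst hvh
      have key : ∀ d d', N.IsGall s d d' v → N.gallVerts s d d' v = N.gallVerts s c c' v →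
          ∀ x, x ≠ v → N.IsAncestor d x → N.IsAncestor x v →
          Relation.ReflTransGen (fun a b => a ∈ N.gallVerts s c c' v \ {v} ∧
            b ∈ N.gallVerts s c c' v \ {v} ∧ (N.Adj a b ∨ N.Adj b a)) x s := by
        intro d d' hd hdd x hxv hdx hxh
        rw [← hdd]
        have hzmem : ∀ z, N.IsAncestor d z → N.IsAncestor z x →
            z ∈ N.gallVerts s d d' v \ {v} := by
          intro z hz hz'
          refine ⟨Or.inr ⟨Or.inl hz, hz'.trans hxh⟩, ?_⟩
          rintro rfl
          exact hxv (hN.antisymm hxh hz')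
        exact (hdx.connected_symm hzmem).tail ⟨hzmem d (.refl d) hdx,
          ⟨Or.inl rfl, Ne.symm hvs⟩, Or.inr hd.adj_left⟩
      refine connectedOn_of_hub s fun x hx => ?_
      rcases hx.1 with rfl | ⟨hx1 | hx1, hx2⟩
      · exact .refl
      · exact key c c' hg rfl x hx.2 hx1 hx2
      · exact key c' c hg.symm hswap x hx.2 hx1 hx2
    have hsh : Relation.ReflTransGen (fun a b => a ∈ N.gallVerts s c c' h \ {v} ∧
        b ∈ N.gallVerts s c c' h \ {v} ∧ (N.Adj a b ∨ N.Adj b a)) s h := by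
      by_cases hv : N.IsAncestor c v ∧ N.IsAncestor v h
      · exact hsource c' c hg.symm hswap v hvs
          fun hv' => hvh (hg.highest v hv.1 hv'.1 hv.2)
      · exact hsource c c' hg rfl v hvs hv
    refine connectedOn_of_hub h fun x hx => ?_
    rcases hx.1 with rfl | ⟨hx1 | hx1, hx2⟩
    · exact hsh
    · rcases hside c c' hg rfl v hvh hvs x hx.2 hx1 hx2 with h1 | ⟨-, h1⟩
      exacts [h1, h1.trans hsh]
    · rcases hside c' c hg.symm hswap v hvh hvs x hx.2 hx1 hx2 with h1 | ⟨-, h1⟩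
      exacts [h1, h1.trans hsh]
  refine ⟨connectedOn_of_hub h fun x hx => ?_, hdel⟩
  rcases hx with rfl | ⟨hx1, hx2⟩
  · refine (hg.left.connected fun z hz hz' => Or.inr ⟨Or.inl hz, hz'⟩).head
      ⟨Or.inl rfl, hg.left_mem, Or.inl hg.adj_left⟩
  · exact hx2.connected fun z hz hz' => Or.inr ⟨hx1.imp (·.trans hz) (·.trans hz), hz'⟩

/-- Galls that share two vertices have the same sink. -/
theorem sink_eq [Finite W] {X : Set W} (hN : N.IsGalledTree X) (hg : N.IsGall s c c' h)
    {t d d' k x y : W} (hg' : N.IsGall t d d' k) (hxy : x ≠ y) (hx : x ∈ N.gallVerts s c c' h)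
    (hx' : x ∈ N.gallVerts t d d' k) (hy : y ∈ N.gallVerts s c c' h)
    (hy' : y ∈ N.gallVerts t d d' k) : h = k := by
  obtain ⟨hh, hhp⟩ := hg.parents hN
  obtain ⟨hk, hkp⟩ := hg'.parents hN
  exact hN.eq_of_biconnectedOn ((hg.biconnectedOn hN.acyclic).union
    (hg'.biconnectedOn hN.acyclic) ⟨x, ⟨hx, hx'⟩, y, ⟨hy, hy'⟩, hxy⟩) hh hk
    (Or.inl hg.sink_mem) (Or.inr hg'.sink_mem) (fun u hu => Or.inl (hhp u hu))
    (fun u hu => Or.inr (hkp u hu))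

end IsGall

/-- Two children of `s` with a common descendant give rise to a gall. -/
theorem IsAcyclic.exists_isGall [Finite W] (hN : N.IsAcyclic) {s c c' y : W} (hc : N.Adj s c)
    (hc' : N.Adj s c') (hne : c ≠ c') (hy : N.IsAncestor c y) (hy' : N.IsAncestor c' y) :
    ∃ h, N.IsGall s c c' h ∧ N.IsAncestor h y := by
  obtain ⟨h, ⟨h1, h2, h3⟩, hmax⟩ := hN.exists_highest
    (P := fun z => N.IsAncestor c z ∧ N.IsAncestor c' z ∧ N.IsAncestor z y) ⟨y, hy, hy', .refl y⟩
  exact ⟨h, ⟨hc, hc', hne, h1, h2, fun x hx hx' hxh => hmax x ⟨hx, hx', hxh.trans h3⟩ hxh⟩, h3⟩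

/-- A vertex with two parents is the sink of a gall, whose source is a lowest common ancestor of
the parents. -/
theorem IsGalledTree.exists_isGall_of_parents [Finite W] {X : Set W} (hN : N.IsGalledTree X)
    {u u' e : W} (hu : N.Adj u e) (hu' : N.Adj u' e) (hne : u ≠ u') :
    ∃ s c c', N.IsGall s c c' e := by
  have hac := hN.acyclic
  obtain ⟨s, ⟨hsu, hsu'⟩, hlow⟩ := hac.exists_lowest
    (P := fun z => N.IsAncestor z u ∧ N.IsAncestor z u') (hN.exists_common_ancestor u u')
  have hpar : ∀ x, N.IsAncestor x e → x ≠ e → N.IsAncestor x u ∨ N.IsAncestor x u' := by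
    intro x hx hxe
    obtain ⟨p, hp, hpe⟩ := hx.exists_parent hxe
    rcases (hN.isHybrid_of_adj hu hu' hne).eq_or_eq hu hu' hne hpe with rfl | rfl
    exacts [Or.inl hp, Or.inr hp]
  have hend : ∀ v', N.Adj s e → N.Adj v' e → N.IsAncestor s v' → s ≠ v' →
      ∃ s c c', N.IsGall s c c' e := by
    intro v' hse hv' hsv' hsne
    obtain ⟨c', hc', hc'v⟩ := hsv'.exists_child hsne
    refine ⟨s, e, c', hse, hc', ?_, .refl e, hc'v.trans (.of_adj hv'),
      fun x h1 _ h2 => hac.antisymm h2 h1⟩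
    rintro rfl
    exact hac.not_isAncestor_of_adj hv' hc'v
  by_cases h1 : s = u
  · exact hend u' (h1 ▸ hu) hu' hsu' (h1 ▸ hne)
  by_cases h2 : s = u'
  · exact hend u (h2 ▸ hu') hu hsu (h2 ▸ hne.symm)
  obtain ⟨c, hc, hcu⟩ := hsu.exists_child h1
  obtain ⟨c', hc', hcu'⟩ := hsu'.exists_child h2
  have hno : ∀ d, N.Adj s d → N.IsAncestor d u → ¬ N.IsAncestor d u' := fun d hd hdu hdu' =>
    hac.ne_of_adj hd (hlow d ⟨hdu, hdu'⟩ (.of_adj hd)).symm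
  refine ⟨s, c, c', hc, hc', ?_, hcu.trans (.of_adj hu), hcu'.trans (.of_adj hu'), ?_⟩
  · rintro rfl
    exact hno c hc hcu hcu'
  · intro x hx hx' hxe
    by_contra hne
    rcases hpar x hxe hne with h | h
    · exact hno c' hc' (hx'.trans h) hcu'
    · exact hno c hc hcu (hx.trans h)

namespace IsGall

variable {s c c' h : W} [Finite W] {X : Set W}

/-- A gall is entered through its source only: all parents of other vertices lie in the gall. -/
theorem mem_of_adj (hN : N.IsGalledTree X) (hg : N.IsGall s c c' h) {u x : W}
    (hx : x ∈ N.gallVerts s c c' h) (hxs : x ≠ s) (hu : N.Adj u x) :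
    u ∈ N.gallVerts s c c' h := by
  by_cases hxh : x = h
  · subst hxh
    exact (hg.parents hN).2 u hu
  obtain ⟨hx1, hx2⟩ := hx.resolve_left hxs
  obtain ⟨u₀, hu₀, hu₀x⟩ : ∃ u₀ ∈ N.gallVerts s c c' h, N.Adj u₀ x := by
    have key : ∀ d, N.Adj s d → N.IsAncestor d x →
        ∃ u₀, (u₀ = s ∨ N.IsAncestor d u₀) ∧ N.Adj u₀ x := by
      intro d hd hdx
      by_cases he : d = x
      · exact ⟨s, Or.inl rfl, he ▸ hd⟩
      · obtain ⟨p, hp, hpx⟩ := hdx.exists_parent he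
        exact ⟨p, Or.inr hp, hpx⟩
    rcases hx1 with hx1 | hx1
    · obtain ⟨u₀, h1, h2⟩ := key c hg.adj_left hx1
      exact ⟨u₀, h1.imp id fun h1 => ⟨Or.inl h1, (IsAncestor.of_adj h2).trans hx2⟩, h2⟩
    · obtain ⟨u₀, h1, h2⟩ := key c' hg.adj_right hx1
      exact ⟨u₀, h1.imp id fun h1 => ⟨Or.inr h1, (IsAncestor.of_adj h2).trans hx2⟩, h2⟩
  by_cases hne : u = u₀
  · exact hne ▸ hu₀
  · -- otherwise `x` would be the sink of another gall that shares the arc from `u₀` to `x`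
    obtain ⟨t, d, d', hg'⟩ := hN.exists_isGall_of_parents hu hu₀x hne
    exact absurd (hg.sink_eq hN hg' (hN.acyclic.ne_of_adj hu₀x).symm hx hg'.sink_mem hu₀
      ((hg'.parents hN).2 u₀ hu₀x)).symm hxh

theorem mem_or_isAncestor (hN : N.IsGalledTree X) (hg : N.IsGall s c c' h) {z x : W}
    (hx : x ∈ N.gallVerts s c c' h) (hz : N.IsAncestor z x) :
    z ∈ N.gallVerts s c c' h ∨ N.IsAncestor z s := by
  induction hz using Relation.ReflTransGen.head_induction_on with
  | refl => exact Or.inl hx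
  | @head a b hab _ ih =>
    rcases ih with ih | ih
    · by_cases hbs : b = s
      · exact Or.inr (.of_adj (hbs ▸ hab))
      · exact Or.inl (hg.mem_of_adj hN ih hbs hab)
    · exact Or.inr ((IsAncestor.of_adj hab).trans ih)

/-- Two vertices below one side of a gall, the second of them in the gall, are comparable as
soon as they have a common descendant. -/
theorem isAncestor_or_isAncestor (hN : N.IsGalledTree X) (hg : N.IsGall s c c' h) {x g a : W}
    (hx : N.IsAncestor c x) (hg1 : N.IsAncestor c g) (hg2 : N.IsAncestor g h)
    (hxa : N.IsAncestor x a) (hga : N.IsAncestor g a) :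
    N.IsAncestor x g ∨ N.IsAncestor g x := by
  have hac := hN.acyclic
  by_contra hcon
  push Not at hcon
  obtain ⟨z, ⟨hcz, hzx, hzg⟩, hlow⟩ := hac.exists_lowest
    (P := fun z => N.IsAncestor c z ∧ N.IsAncestor z x ∧ N.IsAncestor z g) ⟨c, .refl c, hx, hg1⟩
  obtain ⟨z₁, h1, h1x⟩ := hzx.exists_child (by rintro rfl; exact hcon.1 hzg)
  obtain ⟨z₂, h2, h2g⟩ := hzg.exists_child (by rintro rfl; exact hcon.2 hzx)
  have hz12 : z₁ ≠ z₂ := by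
    rintro rfl
    exact hac.ne_of_adj h1
      (hlow z₁ ⟨hcz.trans (.of_adj h1), h1x, h2g⟩ (.of_adj h1)).symm
  obtain ⟨k, hk, -⟩ := hac.exists_isGall h1 h2 hz12 (h1x.trans hxa) (h2g.trans hga)
  have hkh : h = k := hg.sink_eq hN hk (hac.ne_of_adj h2)
    (Or.inr ⟨Or.inl hcz, hzg.trans hg2⟩) hk.source_mem
    (Or.inr ⟨Or.inl (hcz.trans (.of_adj h2)), h2g.trans hg2⟩) hk.right_mem
  subst hkh
  -- the parent of the sink on the opposite side of the first gall is a vertex of the second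
  obtain ⟨p, hp, hp'⟩ := hg.symm.exists_parent_left
  have hpz : N.IsAncestor z p := by
    rcases (hk.parents hN).2 p hp with rfl | ⟨h3 | h3, -⟩
    · exact .refl _
    · exact (IsAncestor.of_adj h1).trans h3
    · exact (IsAncestor.of_adj h2).trans h3
  rcases hp' with ⟨rfl, -⟩ | hp'
  · exact hac.not_isAncestor_of_adj hg.adj_left (hcz.trans hpz)
  · exact hac.ne_of_adj hp (hg.highest p (hcz.trans hpz) hp' (.of_adj hp))

/-- A further child of the source that has common descendants with a side of the gall lies in
the gall itself. -/
theorem isAncestor_child (hN : N.IsGalledTree X) (hg : N.IsGall s c c' h) {d a : W}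
    (hd : N.Adj s d) (hda : N.IsAncestor d a) (hca : N.IsAncestor c a ∨ N.IsAncestor c' a) :
    N.IsAncestor c d ∨ N.IsAncestor c' d := by
  have hac := hN.acyclic
  by_cases h1 : d = c
  · exact Or.inl (h1 ▸ .refl _)
  by_cases h2 : d = c'
  · exact Or.inr (h2 ▸ .refl _)
  have hdh : N.IsAncestor d h := by
    rcases hca with hca | hca
    · obtain ⟨k, hk, -⟩ := hac.exists_isGall hd hg.adj_left h1 hda hca
      rw [hg.sink_eq hN hk (hac.ne_of_adj hg.adj_left) hg.source_mem hk.source_mem hg.left_mem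
        hk.right_mem]
      exact hk.left
    · obtain ⟨k, hk, -⟩ := hac.exists_isGall hd hg.adj_right h2 hda hca
      rw [hg.sink_eq hN hk (hac.ne_of_adj hg.adj_right) hg.source_mem hk.source_mem
        hg.right_mem hk.right_mem]
      exact hk.left
  rcases hg.mem_or_isAncestor hN hg.sink_mem hdh with (h3 | h3) | h3
  · exact absurd h3.symm (hac.ne_of_adj hd)
  · exact h3.1
  · exact absurd h3 (hac.not_isAncestor_of_adj hd)

end IsGall
end Digraph

namespace Digraph

variable {W : Type*} {N : Digraph W}

/-! ### Lowest common ancestors -/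

/-- A common ancestor with no child that is a common ancestor is a lowest one. -/
theorem isLCA_of_forall_child {a b w : W} (ha : N.IsAncestor w a) (hb : N.IsAncestor w b)
    (h : ∀ c, N.Adj w c → N.IsAncestor c a → ¬ N.IsAncestor c b) : N.IsLCA {a, b} w := by
  refine ⟨?_, fun z hz hwz => ?_⟩
  · rintro x (rfl | rfl)
    exacts [ha, hb]
  · by_contra hne
    obtain ⟨c, hc, hcz⟩ := hwz.exists_child (Ne.symm hne)
    exact h c hc (hcz.trans (hz a (Or.inl rfl))) (hcz.trans (hz b (Or.inr rfl)))

/-- Two incomparable lowest common ancestors would lie on the two sides of one gall, whose sink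
is then a lower common ancestor. -/
theorem IsGalledTree.isLCA_unique [Finite W] {X : Set W} (hN : N.IsGalledTree X) {a b u w : W}
    (hu : N.IsLCA {a, b} u) (hw : N.IsLCA {a, b} w) : u = w := by
  have hac := hN.acyclic
  have hua := hu.1 a (Or.inl rfl)
  have hub := hu.1 b (Or.inr rfl)
  have hwa := hw.1 a (Or.inl rfl)
  have hwb := hw.1 b (Or.inr rfl)
  obtain ⟨s, ⟨hsu, hsw⟩, hlow⟩ := hac.exists_lowest
    (P := fun z => N.IsAncestor z u ∧ N.IsAncestor z w) (hN.exists_common_ancestor u w)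
  by_cases h1 : s = u
  · subst h1
    exact (hu.2 w hw.1 hsw).symm
  by_cases h2 : s = w
  · subst h2
    exact hw.2 u hu.1 hsu
  obtain ⟨c, hc, hcu⟩ := hsu.exists_child h1
  obtain ⟨c', hc', hcw⟩ := hsw.exists_child h2
  have hne : c ≠ c' := by
    rintro rfl
    exact hac.ne_of_adj hc (hlow c ⟨hcu, hcw⟩ (.of_adj hc)).symm
  obtain ⟨h, hg, hha⟩ := hac.exists_isGall hc hc' hne (hcu.trans hua) (hcw.trans hwa)
  obtain ⟨k, hk, hhb⟩ := hac.exists_isGall hc hc' hne (hcu.trans hub) (hcw.trans hwb)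
  have hhk : h = k := hg.sink_eq hN hk (hac.ne_of_adj hc) hg.source_mem hk.source_mem
    hg.left_mem hk.left_mem
  subst hhk
  have hcom : ∀ x ∈ ({a, b} : Set W), N.IsAncestor h x := by
    rintro x (rfl | rfl)
    exacts [hha, hhb]
  have hhu : N.IsAncestor h u := by
    rcases hg.isAncestor_or_isAncestor hN hcu hg.left (.refl h) hua hha with h3 | h3
    · exact hu.2 h hcom h3 ▸ .refl _
    · exact h3
  have hhw : N.IsAncestor h w := by
    rcases hg.symm.isAncestor_or_isAncestor hN hcw hg.right (.refl h) hwa hha with h3 | h3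
    · exact hw.2 h hcom h3 ▸ .refl _
    · exact h3
  have hsh : N.IsAncestor s h := (IsAncestor.of_adj hc).trans hg.left
  have := hlow h ⟨hhu, hhw⟩ hsh
  subst this
  exact absurd hg.left (hac.not_isAncestor_of_adj hc)

theorem IsGalledTree.explainedGraph_adj [Finite W] {X : Set W} (hN : N.IsGalledTree X)
    {t : W → NodeLabel} {x y : X} (hxy : x ≠ y) {w : W} (hw : N.IsLCA {(x : W), (y : W)} w) :
    (N.explainedGraph X t).Adj x y ↔ t w = NodeLabel.one := by
  constructor
  · rintro ⟨-, u, hu, hu1⟩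
    rwa [hN.isLCA_unique hw hu]
  · intro h
    exact ⟨hxy, w, hw, h⟩

/-! ### The sides of a gall -/

/-- The number of vertices on the side of `c` of a gall with sink `h` that are not ancestors of
`y`. It is the larger, the closer to the source the descent to `y` leaves the side, and it is
zero for the descendants of `h`. -/
noncomputable def sideRank (N : Digraph W) (c h y : W) : ℕ :=
  {z | N.IsAncestor c z ∧ N.IsAncestor z h ∧ ¬ N.IsAncestor z y}.ncard

namespace IsGall

variable {s c c' h : W} [Finite W] {X : Set W}

theorem sideRank_eq_zero_iff (hg : N.IsGall s c c' h) {y : W} :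
    N.sideRank c h y = 0 ↔ N.IsAncestor h y := by
  rw [sideRank, Set.ncard_eq_zero (Set.toFinite _), Set.eq_empty_iff_forall_notMem]
  constructor
  · intro hz
    by_contra hy
    exact hz h ⟨hg.left, .refl h, hy⟩
  · rintro hy z ⟨-, hz, hzy⟩
    exact hzy (hz.trans hy)

/-- Each side of a gall is a chain. -/
theorem side_total (hN : N.IsGalledTree X) (hg : N.IsGall s c c' h) {z z' : W}
    (h1 : N.IsAncestor c z) (h2 : N.IsAncestor z h) (h1' : N.IsAncestor c z')
    (h2' : N.IsAncestor z' h) : N.IsAncestor z z' ∨ N.IsAncestor z' z :=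
  hg.isAncestor_or_isAncestor hN h1 h1' h2' h2 h2'

theorem sideRank_injOn (hN : N.IsGalledTree X) (hg : N.IsGall s c c' h) {z z' : W}
    (h1 : N.IsAncestor c z) (h2 : N.IsAncestor z h) (h1' : N.IsAncestor c z')
    (h2' : N.IsAncestor z' h) (he : N.sideRank c h z = N.sideRank c h z') : z = z' := by
  have key : ∀ z z', N.IsAncestor c z' → N.IsAncestor z' h → N.IsAncestor z z' →
      N.sideRank c h z = N.sideRank c h z' → z = z' := by
    intro z z' h1' h2' hzz' he
    by_contra hne
    refine (Set.ncard_lt_ncard (t := {x | N.IsAncestor c x ∧ N.IsAncestor x h ∧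
      ¬ N.IsAncestor x z}) ?_ (Set.toFinite _)).ne he.symm
    refine Set.ssubset_iff_of_subset ?_ |>.2 ⟨z', ⟨h1', h2', ?_⟩, fun hz' => hz'.2.2 (.refl _)⟩
    · rintro x ⟨hx1, hx2, hx3⟩
      exact ⟨hx1, hx2, fun hx => hx3 (hx.trans hzz')⟩
    · exact fun hz' => hne (hN.acyclic.antisymm hzz' hz')
  rcases hg.side_total hN h1 h2 h1' h2' with h3 | h3
  · exact key z z' h1' h2' h3 he
  · exact (key z' z h1 h2 h3 he.symm).symm

/-- If the descent to `y` leaves a side of the gall before that to `y'`, then the vertex where it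
does so is the lowest common ancestor of `y` and `y'`. -/
theorem exists_isLCA_of_sideRank_lt (hN : N.IsGalledTree X) (hg : N.IsGall s c c' h) {y y' : W}
    (hy : N.IsAncestor c y) (hlt : N.sideRank c h y' < N.sideRank c h y) :
    ∃ e, N.IsAncestor c e ∧ N.IsAncestor e h ∧ N.sideRank c h e = N.sideRank c h y ∧
      N.IsLCA {y, y'} e := by
  have hac := hN.acyclic
  obtain ⟨e, ⟨he1, he2, hey⟩, hlow⟩ := hac.exists_lowest
    (P := fun z => N.IsAncestor c z ∧ N.IsAncestor z h ∧ N.IsAncestor z y)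
    ⟨c, .refl c, hg.left, hy⟩
  obtain ⟨g, hg1, hg2, hgy', hgy⟩ : ∃ g, N.IsAncestor c g ∧ N.IsAncestor g h ∧
      N.IsAncestor g y' ∧ ¬ N.IsAncestor g y := by
    by_contra hcon
    push Not at hcon
    exact hlt.not_ge (Set.ncard_le_ncard
      (fun z hz => ⟨hz.1, hz.2.1, fun hz' => hz.2.2 (hcon z hz.1 hz.2.1 hz')⟩) (Set.toFinite _))
  have heg : N.IsAncestor e g := (hg.side_total hN he1 he2 hg1 hg2).resolve_right
    fun hge => hgy (hge.trans hey)
  refine ⟨e, he1, he2, ?_, isLCA_of_forall_child hey (heg.trans hgy') ?_⟩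
  · unfold sideRank
    refine congrArg Set.ncard (Set.ext fun z => ?_)
    simp only [Set.mem_ofPred_eq]
    refine and_congr_right fun hz1 => and_congr_right fun hz2 => not_congr ⟨fun h => h.trans hey,
      fun hzy => ?_⟩
    rcases hg.side_total hN he1 he2 hz1 hz2 with h3 | h3
    · rw [hlow z ⟨hz1, hz2, hzy⟩ h3]
      exact .refl e
    · exact h3
  · intro e₁ h1 h1y h1y'
    obtain ⟨e₂, h2, h2g⟩ := heg.exists_child (by rintro rfl; exact hgy hey)
    have hne : e₁ ≠ e₂ := by
      rintro rfl
      exact hac.ne_of_adj h1 (hlow e₁ ⟨he1.trans (.of_adj h1), h2g.trans hg2, h1y⟩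
        (.of_adj h1)).symm
    -- a second way from `e` to `y'` would close a gall that shares an arc with the given one
    obtain ⟨k, hk, -⟩ := hac.exists_isGall h1 h2 hne h1y' (h2g.trans hgy')
    have hkh : h = k := hg.sink_eq hN hk (hac.ne_of_adj h2)
      (Or.inr ⟨Or.inl he1, he2⟩) hk.source_mem
      (Or.inr ⟨Or.inl (he1.trans (.of_adj h2)), h2g.trans hg2⟩) hk.right_mem
    exact hac.ne_of_adj h1 (hlow e₁ ⟨he1.trans (.of_adj h1), hkh ▸ hk.left, h1y⟩
      (.of_adj h1)).symm

/-- On each side of a gall, adjacency of leaves is governed by the rank of the one that branches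
off first. -/
theorem exists_side_label (hN : N.IsGalledTree X) (hg : N.IsGall s c c' h)
    (t : W → NodeLabel) : ∃ l : ℕ → Prop, ∀ y y' : X, N.IsAncestor c y →
      N.sideRank c h y' < N.sideRank c h y →
      ((N.explainedGraph X t).Adj y y' ↔ l (N.sideRank c h y)) := by
  refine ⟨fun i => ∃ z, N.IsAncestor c z ∧ N.IsAncestor z h ∧ N.sideRank c h z = i ∧
    t z = NodeLabel.one, fun y y' hy hlt => ?_⟩
  obtain ⟨e, he1, he2, he, hlca⟩ := hg.exists_isLCA_of_sideRank_lt hN hy hlt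
  have hne : y ≠ y' := by
    rintro rfl
    exact lt_irrefl _ hlt
  rw [hN.explainedGraph_adj hne hlca]
  constructor
  · intro h1
    exact ⟨e, he1, he2, he, h1⟩
  · rintro ⟨z, hz1, hz2, hz, h1⟩
    rwa [hg.sideRank_injOn hN he1 he2 hz1 hz2 (he.trans hz.symm)]

/-- A set of leaves below the two sides of a gall that meets the leaves below the sink and is not
contained in them has a polar labeling, with the leaves below the sink on level zero. -/
theorem hasPolarLabeling (hN : N.IsGalledTree X) (hg : N.IsGall s c c' h) (t : W → NodeLabel)
    {Y : Set X} (hY : ∀ y ∈ Y, N.IsAncestor c y ∨ N.IsAncestor c' y)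
    (hsink : ∃ y ∈ Y, N.IsAncestor h y) (hside : ∃ y ∈ Y, ¬ N.IsAncestor h y) :
    (N.explainedGraph X t).HasPolarLabeling Y := by
  classical
  have hac := hN.acyclic
  have hboth : ∀ y, N.IsAncestor c y → N.IsAncestor c' y → N.IsAncestor h y := by
    intro y hy hy'
    obtain ⟨k, hk, hky⟩ := hac.exists_isGall hg.adj_left hg.adj_right hg.ne hy hy'
    rwa [hg.sink_eq hN hk (hac.ne_of_adj hg.adj_left) hg.source_mem hk.source_mem hg.left_mem
      hk.left_mem]
  obtain ⟨l, hl⟩ := hg.exists_side_label hN t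
  obtain ⟨l', hl'⟩ := hg.symm.exists_side_label hN t
  let F : X → ℤ := fun y =>
    if N.IsAncestor c y then (N.sideRank c h y : ℤ) else - (N.sideRank c' h y : ℤ)
  have F1 : ∀ y : X, N.IsAncestor c y → F y = N.sideRank c h y := fun y hy => if_pos hy
  have F2 : ∀ y : X, N.IsAncestor c' y → F y = - (N.sideRank c' h y : ℤ) := by
    intro y hy'
    by_cases hy : N.IsAncestor c y
    · have hh := hboth y hy hy'
      rw [F1 y hy, hg.sideRank_eq_zero_iff.2 hh, hg.symm.sideRank_eq_zero_iff.2 hh]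
      rfl
    · exact if_neg hy
  have F0 : ∀ y ∈ Y, F y = 0 ↔ N.IsAncestor h y := by
    intro y hy
    rcases hY y hy with h1 | h1
    · rw [F1 y h1, ← hg.sideRank_eq_zero_iff]
      omega
    · rw [F2 y h1, ← hg.symm.sideRank_eq_zero_iff]
      omega
  have Fnonneg : ∀ y ∈ Y, 0 ≤ F y → N.IsAncestor c y := by
    intro y hy h0
    rcases hY y hy with h1 | h1
    · exact h1
    · rw [F2 y h1] at h0
      exact hg.left.trans (hg.symm.sideRank_eq_zero_iff.1 (by omega))
  have Fnonpos : ∀ y ∈ Y, F y ≤ 0 → N.IsAncestor c' y := by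
    intro y hy h0
    rcases hY y hy with h1 | h1
    · rw [F1 y h1] at h0
      exact hg.right.trans (hg.sideRank_eq_zero_iff.1 (by omega))
    · exact h1
  refine ⟨F, fun i => if 0 < i then l i.toNat else l' (-i).toNat, t s = NodeLabel.one,
    ?_, ?_, ?_, ?_, ?_⟩
  · obtain ⟨y, hy, hhy⟩ := hsink
    exact ⟨y, hy, (F0 y hy).2 hhy⟩
  · obtain ⟨y, hy, hhy⟩ := hside
    exact ⟨y, hy, fun h0 => hhy ((F0 y hy).1 h0)⟩
  · intro x hx y hy h0 hlt
    have hxc := Fnonneg x hx (by omega)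
    have hyc := Fnonneg y hy h0
    simp only [show 0 < F x by omega, if_true]
    rw [F1 x hxc, F1 y hyc] at *
    rw [hl x y hxc (by omega), Int.toNat_natCast]
  · intro x hx y hy hlt h0
    have hxc := Fnonpos x hx (by omega)
    have hyc := Fnonpos y hy h0
    simp only [show ¬ 0 < F x by omega, if_false]
    rw [F2 x hxc, F2 y hyc] at *
    rw [hl' x y hxc (by omega), neg_neg, Int.toNat_natCast]
  · intro x hx y hy hx0 hy0
    have hxc := Fnonpos x hx hx0.le
    have hyc := Fnonneg y hy hy0.le
    have hxh : ¬ N.IsAncestor h x := fun hh => hx0.ne ((F0 x hx).2 hh)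
    have hyh : ¬ N.IsAncestor h y := fun hh => hy0.ne' ((F0 y hy).2 hh)
    refine hN.explainedGraph_adj (by rintro rfl; omega) (isLCA_of_forall_child
      ((IsAncestor.of_adj hg.adj_right).trans hxc) ((IsAncestor.of_adj hg.adj_left).trans hyc)
      fun d hd hdx hdy => ?_)
    rcases hg.isAncestor_child hN hd hdx (Or.inr hxc) with h1 | h1
    · exact hxh (hboth x (h1.trans hdx) hxc)
    · exact hyh (hboth y hyc (h1.trans hdy))

end IsGall

/-- In a graph explained by a labeled galled-tree, every set `Y` of at least two leaves has a
polar labeling. Let `w` be a lowest common ancestor of `Y` and `c` a child of `w`. If no other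
child of `w` has a common descendant with `c` in `Y`, then the leaves of `Y` below `c` are split
off; otherwise there is a gall below `w`, and the leaves of `Y` below this gall are split off,
unless they are all of `Y`. -/
theorem IsGalledTree.hasPolarLabeling [Finite W] {X : Set W} (hN : N.IsGalledTree X)
    (t : W → NodeLabel) {Y : Set X} (hY : Y.Nontrivial) :
    (N.explainedGraph X t).HasPolarLabeling Y := by
  have hac := hN.acyclic
  obtain ⟨y₀, hy₀, y₁, hy₁, hy01⟩ := hY
  have hroot : ∃ w, ∀ y ∈ Y, N.IsAncestor w y := by
    obtain ⟨r, -, hr⟩ := hac.exists_highest (P := fun _ => True) ⟨(y₀ : W), trivial⟩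
    refine ⟨r, fun y _ => ?_⟩
    obtain ⟨q, hq, hqy⟩ := hN.exists_common_ancestor r y
    rwa [hr q trivial hq] at hqy
  obtain ⟨w, hw, hlow⟩ := hac.exists_lowest hroot
  have hwy₀ : w ≠ y₀ := by
    rintro rfl
    obtain ⟨c, hc, -⟩ := (hw y₁ hy₁).exists_child fun he => hy01 (Subtype.ext he)
    exact hN.not_adj_of_leaf y₀.2 hc
  obtain ⟨c, hc, hcy₀⟩ := (hw y₀ hy₀).exists_child hwy₀
  have hmiss : ∀ d, N.Adj w d → ∃ y ∈ Y, ¬ N.IsAncestor d y := by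
    intro d hd
    by_contra hcon
    push Not at hcon
    exact hac.ne_of_adj hd (hlow d hcon (.of_adj hd)).symm
  by_cases hgall : ∃ c', N.Adj w c' ∧ c ≠ c' ∧ ∃ y ∈ Y, N.IsAncestor c y ∧ N.IsAncestor c' y
  · obtain ⟨c', hc', hne, y₂, hy₂, hcy₂, hcy₂'⟩ := hgall
    obtain ⟨h, hg, hhy₂⟩ := hac.exists_isGall hc hc' hne hcy₂ hcy₂'
    by_cases hall : ∀ y ∈ Y, N.IsAncestor c y ∨ N.IsAncestor c' y
    · obtain ⟨y₃, hy₃, hcy₃⟩ := hmiss c hc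
      exact hg.hasPolarLabeling hN t hall ⟨y₂, hy₂, hhy₂⟩
        ⟨y₃, hy₃, fun hh => hcy₃ (hg.left.trans hh)⟩
    · push Not at hall
      obtain ⟨y₃, hy₃, hcy₃, hcy₃'⟩ := hall
      refine .of_split (Z := {y : X | N.IsAncestor c y ∨ N.IsAncestor c' y})
        (k := t w = NodeLabel.one) ⟨y₀, hy₀, Or.inl hcy₀⟩
        ⟨y₃, hy₃, fun hh => hh.elim hcy₃ hcy₃'⟩ ?_
      rintro a ⟨ha, haZ⟩ b ⟨hb, hbZ⟩
      refine hN.explainedGraph_adj (by rintro rfl; exact hbZ haZ)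
        (isLCA_of_forall_child (hw a ha) (hw b hb) fun d hd hda hdb => hbZ ?_)
      exact (hg.isAncestor_child hN hd hda haZ).imp (·.trans hdb) (·.trans hdb)
  · obtain ⟨y₃, hy₃, hcy₃⟩ := hmiss c hc
    refine .of_split (Z := {y : X | N.IsAncestor c y}) (k := t w = NodeLabel.one)
      ⟨y₀, hy₀, hcy₀⟩ ⟨y₃, hy₃, hcy₃⟩ ?_
    rintro a ⟨ha, haZ⟩ b ⟨hb, hbZ⟩
    refine hN.explainedGraph_adj (by rintro rfl; exact hbZ haZ)
      (isLCA_of_forall_child (hw a ha) (hw b hb) fun d hd hda hdb => ?_)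
    by_cases hcd : c = d
    · exact hbZ (hcd ▸ hdb : N.IsAncestor c b)
    · exact hgall ⟨d, hd, hcd, a, ha, haZ, hda⟩

theorem IsGalledTree.leaves_nonempty [Finite W] {X : Set W} (hN : N.IsGalledTree X) :
    X.Nonempty := by
  rcases hN.2 with ⟨z, rfl, -⟩ | ⟨⟨r, hr, -, hv⟩, -, -⟩
  · exact Set.singleton_nonempty z
  obtain ⟨m, -, hm⟩ := hN.acyclic.exists_lowest (P := fun _ => True) ⟨r, trivial⟩
  have h0 : N.outDeg m = 0 := by
    rw [outDeg, Set.ncard_eq_zero (Set.toFinite _)]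
    exact Set.eq_empty_of_forall_notMem fun c hc =>
      hN.acyclic.ne_of_adj hc (hm c trivial (.of_adj hc)).symm
  by_contra hX
  have hmX : m ∉ X := fun h => hX ⟨m, h⟩
  have hmr : m ≠ r := by
    rintro rfl
    have := hr.2
    omega
  rcases hv m hmX hmr with h | h
  · have := h.2
    omega
  · have := h.2
    omega

end Digraph

namespace SimpleGraph

variable {V : Type*} {G : SimpleGraph V}

theorem HasPolarLabeling.of_image {V' : Type*} {G' : SimpleGraph V'} (e : G ≃g G')
    {Y : Set V} (h : G'.HasPolarLabeling (e '' Y)) : G.HasPolarLabeling Y := by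
  obtain ⟨f, l, k, h0, h1, h2, h3, h4⟩ := h
  refine ⟨fun x => f (e x), l, k, ?_, ?_, ?_, ?_, ?_⟩
  · obtain ⟨_, ⟨v, hv, rfl⟩, hv0⟩ := h0
    exact ⟨v, hv, hv0⟩
  · obtain ⟨_, ⟨v, hv, rfl⟩, hv0⟩ := h1
    exact ⟨v, hv, hv0⟩
  · intro x hx y hy hy0 hlt
    rw [← e.map_adj_iff]
    exact h2 _ ⟨x, hx, rfl⟩ _ ⟨y, hy, rfl⟩ hy0 hlt
  · intro x hx y hy hlt hy0
    rw [← e.map_adj_iff]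
    exact h3 _ ⟨x, hx, rfl⟩ _ ⟨y, hy, rfl⟩ hlt hy0
  · intro x hx y hy hx0 hy0
    rw [← e.map_adj_iff]
    exact h4 _ ⟨x, hx, rfl⟩ _ ⟨y, hy, rfl⟩ hx0 hy0

theorem IsGaTEx.nonempty (h : G.IsGaTEx) : Nonempty V := by
  obtain ⟨W, _, N, X, t, hN, -, ⟨e⟩⟩ := h
  obtain ⟨x, hx⟩ := hN.leaves_nonempty
  exact ⟨e.symm ⟨x, hx⟩⟩

theorem IsGaTEx.isCollapsible [Finite V] (h : G.IsGaTEx) : G.IsCollapsible 1 := by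
  have := h.nonempty
  obtain ⟨W, _, N, X, t, hN, -, ⟨e⟩⟩ := h
  exact isCollapsible_of_collapses (collapses_of_hasPolarLabeling Set.univ_nonempty
    fun Z _ hZ => .of_image e (hN.hasPolarLabeling t (hZ.image e.injective)))

theorem IsPseudoCograph.isCollapsible [Finite V] (hV : 4 ≤ Nat.card V)
    (h : G.IsPseudoCograph) : G.IsCollapsible 1 := by
  rcases h with h | ⟨v, A, B, h⟩
  · omega
  · exact isCollapsible_of_collapses (collapses_of_hasPolarLabeling ⟨v, trivial⟩
      fun Z _ hZ => h.hasPolarLabeling hZ)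

end SimpleGraph

theorem mainTheorem3 {V : Type*} [Finite V] (G : SimpleGraph V) :
    (G.IsPrimitive → G.IsPseudoCograph → G.IsCollapsible 1 ∧ G.twinWidth = 1) ∧
    (G.IsGaTEx → (G.IsCollapsible 1 ∧ G.twinWidth ≤ 1) ∧
      (G.twinWidth = 1 ↔ ¬ G.IsCograph)) := by
  refine ⟨fun hprim hpc => ?_, fun hG => ?_⟩
  · have : Nonempty V := (Nat.card_pos_iff.1 (by have := hprim.1; omega)).1
    have hcol := hpc.isCollapsible hprim.1
    exact ⟨hcol, (SimpleGraph.twinWidth_eq_one_iff hcol).2 hprim.not_isCograph⟩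
  · have := hG.nonempty
    have hcol := hG.isCollapsible
    exact ⟨⟨hcol, Nat.sInf_le hcol⟩, SimpleGraph.twinWidth_eq_one_iff hcol⟩
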